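/- Let $N\in\mathbb N$ and $g:\{0,1\}^N\to\mathbb R$. For $x\in\{0,1\}^N$ let $x^{(i)}$ be $x$ with its $i$-th coordinate flipped. A control is a family of transition rates $u_t(y,x)$ (from $x$ to $y$), $t\in[0,1]$, continuous in $t$, with $u_t(y,x)\ge 0$ for $y\ne x$, $u_t(y,x)=0$ if $y$ and $x$ differ in more than one coordinate, and $u_t(x,x)=-\sum_{y\neq x}u_t(y,x)$. Given an initial distribution $\mu_0$ on $\{0,1\}^N$, let $p^u$ be the trajectory distribution on $[0,1]$ of the continuous-time Markov chain $(X_t)$ with initial distribution $\mu_0$ and rates $u$. For $\lambda,\tau>0$ let $p^{\mathrm{base}}$ be the trajectory distribution of the chain with the same initial distribution and the homogeneous rates $u^{\mathrm{base}}_t(x^{(i)},x)=\rho_\tau:=\sigma(-\lambda/\tau)$, where $\sigma(z)=1/(1+e^{-z})$. An optimal control $u^{\star}=u^{\star,\tau}$ is a minimizer of $$\min_u\ \mathbb E_{p^u}[g(X_1)]+\tau\,\mathrm{KL}(p^u\,\|\,p^{\mathrm{base}}).$$ For all $\lambda,\tau>0$ and all $\mu_0$ an optimal control exists. Moreover there is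 $\lambda_0>0$, depending only on $g$, such that for every $\lambda\in(0,\lambda_0)$, every $\mu_0$, every choice of optimal controls $u^{\star,\tau}$ $(\tau>0)$, every $x\in\{0,1\}^N$ for which the global minimizer $x^\star$ of $g$ closest to $x$ in Hamming distance is unique, every $t\in[0,1)$ and every coordinate $i$, $$\lim_{\tau\to0^+}u^{\star,\tau}_t(x^{(i)},x)=\begin{cases}\dfrac1{1-t},& x_i\neq x_i^\star,\\[4pt] 0,& x_i=x_i^\star.\end{cases}$$ -/

import Mathlib

open Set Filter Topology MeasureTheory

noncomputable section

namespace BitFlipControl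

/-- The state space `{0,1}^N`. -/
abbrev State (N : ℕ) : Type := Fin N → Bool

/-- The state `x^{(i)}`, obtained from `x` by flipping the `i`-th coordinate. -/
def flip {N : ℕ} (x : State N) (i : Fin N) : State N :=
  Function.update x i (!(x i))

/-- Time-dependent transition rates on `{0,1}^N`: `u t y x` is the rate `u_t(y, x)` of jumping
from `x` to `y` at time `t`. Only the times `t ∈ [0, 1]` matter. -/
abbrev Rates (N : ℕ) : Type := ℝ → State N → State N → ℝ

/-- Admissible controls: transition rates on `[0, 1]` which are nonnegative off the diagonal, allow
single-bit flips only, have total outflow zero, and depend continuously on time. -/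
structure IsAdmissible {N : ℕ} (u : Rates N) : Prop where
  nonneg : ∀ t ∈ Icc (0 : ℝ) 1, ∀ x y : State N, y ≠ x → 0 ≤ u t y x
  single_flip : ∀ t ∈ Icc (0 : ℝ) 1, ∀ x y : State N, 1 < hammingDist x y → u t y x = 0
  diag : ∀ t ∈ Icc (0 : ℝ) 1, ∀ x : State N, u t x x = -∑ y ∈ Finset.univ.erase x, u t y x
  continuous : ∀ x y : State N, ContinuousOn (fun t => u t y x) (Icc (0 : ℝ) 1)

/-- `p s t y x` is the probability of being in `y` at time `t` given that the state at time `s`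
is `x`, for the continuous-time Markov chain with rates `u` (`0 ≤ s ≤ t ≤ 1`): it is the solution
of the Kolmogorov forward equation (master equation) started from the point mass at `x`. -/
structure IsTransitionFunction {N : ℕ} (u : Rates N) (p : ℝ → ℝ → State N → State N → ℝ) :
    Prop where
  initial : ∀ s ∈ Icc (0 : ℝ) 1, ∀ x y : State N, p s s y x = if y = x then 1 else 0
  forward : ∀ s ∈ Icc (0 : ℝ) 1, ∀ t ∈ Icc s 1, ∀ x y : State N,
    HasDerivWithinAt (fun r => p s r y x) (∑ z : State N, u t y z * p s t z x) (Icc s 1) t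

/-- Trajectories `X = (X_t)_{t ∈ [0,1]}`, with the σ-algebra generated by the evaluations. -/
abbrev Path (N : ℕ) : Type := unitInterval → State N

/-- `Q` is the trajectory distribution of the continuous-time Markov chain on `{0,1}^N` with
initial distribution `μ₀` and transition rates `u`, described by its finite-dimensional
distributions: for `0 = t₀ ≤ t₁ ≤ … ≤ tₙ ≤ 1`,
`Q (X_{t₀} = x₀, …, X_{tₙ} = xₙ) = μ₀(x₀) ∏ₖ p_{tₖ,tₖ₊₁}(xₖ₊₁ | xₖ)`. -/
def IsChainLaw {N : ℕ} (μ₀ : PMF (State N)) (u : Rates N) (Q : Measure (Path N)) : Prop :=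
  IsProbabilityMeasure Q ∧
    ∃ p : ℝ → ℝ → State N → State N → ℝ, IsTransitionFunction u p ∧
      ∀ (n : ℕ) (t : Fin (n + 1) → unitInterval) (x : Fin (n + 1) → State N),
        Monotone t → t 0 = 0 →
        Q.real {X : Path N | ∀ k, X (t k) = x k} =
          (μ₀ (x 0)).toReal *
            ∏ k : Fin n, p (t k.castSucc) (t k.succ) (x k.succ) (x k.castSucc)

/-- The base rate `ρ_τ = σ(-lam / τ)`, with `σ` the logistic sigmoid. -/
def baseRate (lam τ : ℝ) : ℝ := Real.sigmoid (-lam / τ)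

/-- The homogeneous base rates: every single-bit flip occurs at rate `ρ_τ`. -/
def baseRates (N : ℕ) (lam τ : ℝ) : Rates N := fun _ y x =>
  if y = x then -(N * baseRate lam τ)
  else if hammingDist y x = 1 then baseRate lam τ
  else 0

/-- The KL-regularized control cost `E_Q[g(X_1)] + τ KL(Q ‖ P)` of a trajectory distribution `Q`
relative to the reference trajectory distribution `P`. It is `⊤` when the divergence is infinite. -/
def cost {N : ℕ} (g : State N → ℝ) (τ : ℝ) (P Q : Measure (Path N)) : EReal :=
  ((∫ X, g (X 1) ∂Q : ℝ) : EReal) + (τ : EReal) * ((InformationTheory.klDiv Q P : ENNReal) : EReal)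

/-- `u` is an optimal control for
`min_u E_{p^u}[g(X_1)] + τ KL(p^u ‖ p^base)`, where `p^base` is the chain with the homogeneous base
rates, and where all the chains have the initial distribution `μ₀`. -/
def IsOptimalControl {N : ℕ} (g : State N → ℝ) (lam τ : ℝ) (μ₀ : PMF (State N)) (u : Rates N) :
    Prop :=
  IsAdmissible u ∧
    ∃ P Q : Measure (Path N), IsChainLaw μ₀ (baseRates N lam τ) P ∧ IsChainLaw μ₀ u Q ∧
      ∀ (v : Rates N) (R : Measure (Path N)), IsAdmissible v → IsChainLaw μ₀ v R →
        cost g τ P Q ≤ cost g τ P R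

/-- `y` is a (global) minimizer of `g` on `{0,1}^N`. -/
def IsMinimizer {N : ℕ} (g : State N → ℝ) (y : State N) : Prop := ∀ z : State N, g y ≤ g z

/-- `xs` is the unique minimizer of `g` that is closest to `x` in the Hamming distance. -/
def IsUniqueClosestMinimizer {N : ℕ} (g : State N → ℝ) (x xs : State N) : Prop :=
  IsMinimizer g xs ∧
    ∀ y : State N, IsMinimizer g y → y ≠ xs → hammingDist x xs < hammingDist x y

end BitFlipControl

end

noncomputable section

namespace BitFlipControl

variable {N : ℕ}

/-! The control problem is a Gibbs variational problem. Let `P` be the base law and h_t(x) the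
base-chain expectation of exp(-g(X_1)/τ) given X_t = x (`desirability`). Tilting `P` by
exp(-g(X_1)/τ) / h_0(X_0) gives `optimalLaw`; dividing by h_0(X_0), rather than by a constant,
preserves the initial distribution. For every chain law R with finite divergence from `P`, the cost
equals τ KL(R ‖ `optimalLaw`) minus a constant depending only on μ₀ and h_0 (`IsChainLaw.cost_eq`).
Since h solves the backward equation, the tilted law is again a chain law, with Doob-transformed
rates (`HasLawAt.tilted`, `isTransitionFunction_doobRates`). So the infimum is attained, and only by
that law.

An optimal control is therefore determined on [0,1): equal laws have equal transition functions from
any time s > 0, where every state has positive probability; differentiating at s gives the rates,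
and continuity gives s = 0 (`IsOptimalControl.eq_optimalRates`).

Base bits flip independently, so, with r the odds that a bit is flipped after time 1 - t and m = min
g, h_t(x) is a factor independent of x times ∑_y r^{d(x,y)} exp(-(g(y) - m)/τ). Here r ~ (1 - t)
ρ_τ, and ρ_τ decays like exp(-λ/τ). If Nλ is below the gap between the two lowest values of g,
non-minimizers are negligible even against r^N, and the sum is asymptotic to r^{d(x,x*)}
(`tendsto_sum_flipOdds`). The rate ρ_τ h_t(x^(i)) / h_t(x) thus behaves like ρ_τ / r → 1/(1 - t) for
a flip towards x*, and is O(ρ_τ) otherwise.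

The base law itself must be constructed: laws correct at finitely many times are prolonged one time
at a time, and a limit is taken by compactness (`exists_isChainLaw_baseRates`). -/

/-! ### Bit flips and the Hamming distance -/

lemma flip_apply_self (x : State N) (i : Fin N) : flip x i i = !(x i) := by simp [flip]

lemma flip_apply_of_ne (x : State N) {i j : Fin N} (h : j ≠ i) : flip x i j = x j := by
  simp [flip, h]

lemma flip_injective (x : State N) : Function.Injective (flip x) := by
  intro i j h
  by_contra hij
  have := congrFun h i
  rw [flip_apply_self, flip_apply_of_ne x hij] at this
  cases hx : x i <;> simp [hx] at this

lemma flip_ne (x : State N) (i : Fin N) : flip x i ≠ x := by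
  intro h
  have := congrFun h i
  rw [flip_apply_self] at this
  cases hx : x i <;> simp [hx] at this

lemma hammingDist_flip_of_ne {x y : State N} {i : Fin N} (h : x i ≠ y i) :
    hammingDist x y = hammingDist (flip x i) y + 1 := by
  have : ({j | x j ≠ y j} : Finset (Fin N)) = insert i ({j | flip x i j ≠ y j} : Finset _) := by
    ext j
    by_cases hj : j = i
    · subst hj; simp [h]
    · simp [flip_apply_of_ne x hj, hj]
  unfold hammingDist
  rw [this, Finset.card_insert_of_notMem]
  simp only [Finset.mem_filter, Finset.mem_univ, true_and, not_not, flip_apply_self]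
  revert h
  cases x i <;> cases y i <;> simp

lemma hammingDist_flip_of_eq {x y : State N} {i : Fin N} (h : x i = y i) :
    hammingDist (flip x i) y = hammingDist x y + 1 := by
  have h' : flip x i i ≠ y i := by
    rw [flip_apply_self, h]; cases y i <;> simp
  have hx : flip (flip x i) i = x := by
    ext j
    by_cases hj : j = i
    · subst hj; simp [flip_apply_self]
    · simp [flip_apply_of_ne _ hj]
  rw [hammingDist_flip_of_ne h', hx]

lemma hammingDist_self_flip (x : State N) (i : Fin N) : hammingDist (flip x i) x = 1 := by
  rw [hammingDist_flip_of_eq rfl, hammingDist_self]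

lemma exists_eq_flip_of_hammingDist_eq_one {x y : State N} (h : hammingDist y x = 1) :
    ∃ i, y = flip x i := by
  have : ∃ i, x i ≠ y i := by
    by_contra! hc
    have : x = y := funext hc
    simp [this] at h
  obtain ⟨i, hi⟩ := this
  refine ⟨i, ?_⟩
  have h2 := hammingDist_flip_of_ne hi
  rw [hammingDist_comm x y, h] at h2
  exact (hammingDist_eq_zero.1 (by omega)).symm

lemma sum_erase_eq_sum_flip (x : State N) (f : State N → ℝ)
    (hf : ∀ y, 1 < hammingDist y x → f y = 0) :
    ∑ y ∈ Finset.univ.erase x, f y = ∑ i, f (flip x i) := by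
  classical
  rw [← Finset.sum_image (s := Finset.univ) (g := flip x) (f := f)
    (fun i _ j _ h => flip_injective x h)]
  symm
  apply Finset.sum_subset
  · intro y hy
    obtain ⟨i, -, rfl⟩ := Finset.mem_image.1 hy
    simp [flip_ne]
  · intro y hy hy'
    apply hf
    by_contra! hle
    have hne : y ≠ x := Finset.ne_of_mem_erase hy
    have h0 : hammingDist y x ≠ 0 := by simpa using hne
    obtain ⟨i, rfl⟩ := exists_eq_flip_of_hammingDist_eq_one (by omega : hammingDist y x = 1)
    exact hy' (Finset.mem_image_of_mem _ (Finset.mem_univ _))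

/-! ### The base rates and their explicit transition kernel -/

lemma baseRate_pos (lam τ : ℝ) : 0 < baseRate lam τ := Real.sigmoid_pos _

lemma baseRates_self (lam τ t : ℝ) (x : State N) :
    baseRates N lam τ t x x = -(N * baseRate lam τ) := by simp [baseRates]

lemma baseRates_flip (lam τ t : ℝ) (x : State N) (i : Fin N) :
    baseRates N lam τ t (flip x i) x = baseRate lam τ := by
  simp [baseRates, flip_ne, hammingDist_self_flip]

lemma baseRates_comm (lam τ t : ℝ) (x y : State N) :
    baseRates N lam τ t x y = baseRates N lam τ t y x := by
  simp [baseRates, hammingDist_comm x y, eq_comm]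

lemma baseRates_eq_zero (lam τ t : ℝ) {x y : State N} (h : 1 < hammingDist y x) :
    baseRates N lam τ t y x = 0 := by
  have : y ≠ x := by rintro rfl; simp at h
  simp [baseRates, this, h.ne']

/-- The action of the base generator on functions. -/
lemma sum_baseRates_mul (lam τ t : ℝ) (x : State N) (f : State N → ℝ) :
    ∑ z, baseRates N lam τ t z x * f z = ∑ i, baseRate lam τ * (f (flip x i) - f x) := by
  rw [← Finset.add_sum_erase _ _ (Finset.mem_univ x), sum_erase_eq_sum_flip, baseRates_self]
  · simp only [baseRates_flip, mul_sub, Finset.sum_sub_distrib, Finset.sum_const,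
      Finset.card_univ, Fintype.card_fin, nsmul_eq_mul]
    ring
  · intro y hy
    rw [baseRates_eq_zero _ _ _ hy, zero_mul]

lemma baseRates_nonneg (lam τ t : ℝ) {x y : State N} (h : y ≠ x) :
    0 ≤ baseRates N lam τ t y x := by
  simp only [baseRates, h, if_false]
  split_ifs
  exacts [(baseRate_pos _ _).le, le_rfl]

lemma sum_baseRates (lam τ t : ℝ) (x : State N) : ∑ z, baseRates N lam τ t z x = 0 := by
  simpa using sum_baseRates_mul lam τ t x (fun _ => 1)

/-- The probability that a bit flipping at rate `ρ` is back (`b = true`) or flipped (`b = false`)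
after time `r`. -/
def bitProb (ρ r : ℝ) (b : Bool) : ℝ :=
  if b then (1 + Real.exp (-(2 * ρ * r))) / 2 else (1 - Real.exp (-(2 * ρ * r))) / 2

/-- The transition probability from `x` to `y` in time `r`, when every bit flips independently at
rate `ρ`. -/
def flipKernel (ρ r : ℝ) (y x : State N) : ℝ := ∏ i, bitProb ρ r (y i == x i)

lemma bitProb_zero (ρ : ℝ) (b : Bool) : bitProb ρ 0 b = if b then 1 else 0 := by
  cases b <;> simp [bitProb]

lemma bitProb_nonneg {ρ r : ℝ} (hρ : 0 < ρ) (hr : 0 ≤ r) (b : Bool) : 0 ≤ bitProb ρ r b := by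
  have : Real.exp (-(2 * ρ * r)) ≤ 1 := by
    rw [Real.exp_le_one_iff]; have := mul_nonneg hρ.le hr; linarith
  have := Real.exp_pos (-(2 * ρ * r))
  cases b <;> simp only [bitProb, if_true, Bool.false_eq_true, if_false] <;> linarith

lemma bitProb_pos {ρ r : ℝ} (hρ : 0 < ρ) (hr : 0 < r) (b : Bool) : 0 < bitProb ρ r b := by
  have : Real.exp (-(2 * ρ * r)) < 1 := by
    rw [Real.exp_lt_one_iff]; have := mul_pos hρ hr; linarith
  have := Real.exp_pos (-(2 * ρ * r))
  cases b <;> simp only [bitProb, if_true, Bool.false_eq_true, if_false] <;> linarith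

lemma bitProb_true_pos (ρ r : ℝ) : 0 < bitProb ρ r true := by
  have := Real.exp_pos (-(2 * ρ * r))
  simp only [bitProb, if_true]; linarith

lemma hasDerivAt_bitProb (ρ r : ℝ) (b : Bool) :
    HasDerivAt (fun r => bitProb ρ r b) (ρ * (bitProb ρ r (!b) - bitProb ρ r b)) r := by
  have h : HasDerivAt (fun r : ℝ => Real.exp (-(2 * ρ * r)))
      (Real.exp (-(2 * ρ * r)) * (-(2 * ρ * 1))) r :=
    (((hasDerivAt_id r).const_mul (2 * ρ)).neg).exp
  cases b
  · simp only [bitProb, Bool.false_eq_true, if_false, Bool.not_false, if_true]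
    exact ((h.const_sub 1).div_const 2).congr_deriv (by ring)
  · simp only [bitProb, Bool.false_eq_true, if_false, Bool.not_true, if_true]
    exact ((h.const_add 1).div_const 2).congr_deriv (by ring)

lemma sum_bitProb_mul (ρ r s : ℝ) (b c : Bool) :
    ∑ d : Bool, bitProb ρ s (b == d) * bitProb ρ r (d == c) = bitProb ρ (r + s) (b == c) := by
  have : Real.exp (-(2 * ρ * (r + s))) = Real.exp (-(2 * ρ * r)) * Real.exp (-(2 * ρ * s)) := by
    rw [← Real.exp_add]; ring_nf
  cases b <;> cases c <;> simp [bitProb, this] <;> ring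

lemma sum_bitProb (ρ r : ℝ) (c : Bool) : ∑ b : Bool, bitProb ρ r (b == c) = 1 := by
  cases c <;> simp [bitProb] <;> ring

lemma flipKernel_zero (ρ : ℝ) (y x : State N) : flipKernel ρ 0 y x = if y = x then 1 else 0 := by
  simp only [flipKernel, bitProb_zero]
  split_ifs with h
  · simp [h]
  · obtain ⟨i, hi⟩ := Function.ne_iff.1 h
    exact Finset.prod_eq_zero (Finset.mem_univ i) (by simp [hi])

lemma flipKernel_nonneg {ρ r : ℝ} (hρ : 0 < ρ) (hr : 0 ≤ r) (y x : State N) :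
    0 ≤ flipKernel ρ r y x := Finset.prod_nonneg fun _ _ => bitProb_nonneg hρ hr _

lemma flipKernel_pos {ρ r : ℝ} (hρ : 0 < ρ) (hr : 0 < r) (y x : State N) :
    0 < flipKernel ρ r y x := Finset.prod_pos fun _ _ => bitProb_pos hρ hr _

lemma flipKernel_self_pos (ρ r : ℝ) (x : State N) : 0 < flipKernel ρ r x x :=
  Finset.prod_pos fun _ _ => by simpa using bitProb_true_pos ρ r

lemma flipKernel_comm (ρ r : ℝ) (y x : State N) : flipKernel ρ r y x = flipKernel ρ r x y := by
  simp only [flipKernel]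
  exact Finset.prod_congr rfl fun i _ => by rw [BEq.comm]

lemma sum_flipKernel (ρ r : ℝ) (x : State N) : ∑ y, flipKernel ρ r y x = 1 := by
  simp only [flipKernel]
  rw [← Fintype.prod_sum (fun i b => bitProb ρ r (b == x i))]
  simp only [sum_bitProb, Finset.prod_const_one]

/-- Chapman–Kolmogorov: the sum over intermediate states factors over the bits. -/
lemma sum_flipKernel_mul (ρ r s : ℝ) (y x : State N) :
    ∑ z, flipKernel ρ s y z * flipKernel ρ r z x = flipKernel ρ (r + s) y x := by
  simp only [flipKernel, ← Finset.prod_mul_distrib]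
  rw [← Fintype.prod_sum (fun i b => bitProb ρ s (y i == b) * bitProb ρ r (b == x i))]
  simp only [sum_bitProb_mul]

/-- Isolates the dependence on the states, which is only through their Hamming distance; the small-τ
analysis rests on this form. -/
lemma flipKernel_eq_pow (ρ r : ℝ) (y x : State N) :
    flipKernel ρ r y x = bitProb ρ r true ^ N *
      (bitProb ρ r false / bitProb ρ r true) ^ hammingDist x y := by
  have hb := (bitProb_true_pos ρ r).ne'
  have : ∀ i, bitProb ρ r (y i == x i) = bitProb ρ r true *
      (if x i ≠ y i then bitProb ρ r false / bitProb ρ r true else 1) := by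
    intro i
    by_cases h : x i = y i
    · simp [h]
    · have h' : (y i == x i) = false := by simpa using fun h2 => h h2.symm
      simp only [h', ne_eq, h, not_false_eq_true, if_true]
      field_simp
  simp only [flipKernel, this, Finset.prod_mul_distrib, Finset.prod_const, Finset.card_univ,
    Fintype.card_fin, hammingDist, Finset.prod_ite, one_pow, mul_one]

/-- The product rule differentiates one bit at a time, and each one-bit derivative is the flip
generator on that bit. Symmetry of the rates lets the generator act on the end state, which gives
the forward equation. -/
lemma hasDerivAt_flipKernel (lam τ t r : ℝ) (y x : State N) :
    HasDerivAt (fun r => flipKernel (baseRate lam τ) r y x)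
      (∑ z, baseRates N lam τ t y z * flipKernel (baseRate lam τ) r z x) r := by
  simp only [baseRates_comm lam τ t y]
  rw [sum_baseRates_mul]
  have := HasDerivAt.fun_finsetProd (u := (Finset.univ : Finset (Fin N)))
    (f := fun i r => bitProb (baseRate lam τ) r (y i == x i))
    (fun i _ => hasDerivAt_bitProb (baseRate lam τ) r (y i == x i))
  unfold flipKernel
  refine this.congr_deriv ?_
  refine Finset.sum_congr rfl fun i _ => ?_
  rw [← Finset.mul_prod_erase _ _ (Finset.mem_univ i),
    ← Finset.mul_prod_erase _ (fun j => bitProb _ r (y j == x j)) (Finset.mem_univ i)]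
  have h1 : (flip y i i == x i) = !(y i == x i) := by
    rw [flip_apply_self]; cases y i <;> cases x i <;> rfl
  have h2 : ∏ j ∈ Finset.univ.erase i, bitProb (baseRate lam τ) r (flip y i j == x j) =
      ∏ j ∈ Finset.univ.erase i, bitProb (baseRate lam τ) r (y j == x j) :=
    Finset.prod_congr rfl fun j hj => by rw [flip_apply_of_ne y (Finset.ne_of_mem_erase hj)]
  rw [h1, h2, smul_eq_mul]
  ring

lemma isTransitionFunction_flipKernel (lam τ : ℝ) :
    IsTransitionFunction (baseRates N lam τ)
      (fun s t y x => flipKernel (baseRate lam τ) (t - s) y x) where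
  initial s _ x y := by simp [flipKernel_zero]
  forward s _ t _ x y := by
    have := (hasDerivAt_flipKernel lam τ t (t - s) y x).comp t ((hasDerivAt_id t).sub_const s)
    simpa [Function.comp_def] using this.hasDerivWithinAt

/-- The transition function of the base chain is unique. -/
lemma IsTransitionFunction.eq_flipKernel {lam τ : ℝ} {p : ℝ → ℝ → State N → State N → ℝ}
    (hp : IsTransitionFunction (baseRates N lam τ) p) {s t : ℝ} (hs : s ∈ Icc (0 : ℝ) 1)
    (ht : t ∈ Icc s 1) (y x : State N) :
    p s t y x = flipKernel (baseRate lam τ) (t - s) y x := by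
  -- For fixed s and x the forward equation is a linear ODE with constant coefficients, so Lipschitz
  -- uniqueness applies.
  let A : Matrix (State N) (State N) ℝ := fun y z => baseRates N lam τ 0 y z
  let L : (State N → ℝ) →L[ℝ] (State N → ℝ) := LinearMap.toContinuousLinearMap A.mulVecLin
  have key : ∀ q : ℝ → ℝ → State N → State N → ℝ, IsTransitionFunction (baseRates N lam τ) q →
      ContinuousOn (fun r y => q s r y x) (Icc s 1) ∧
      ∀ r ∈ Ico s 1, HasDerivWithinAt (fun r y => q s r y x) (L (fun y => q s r y x)) (Ici r) r := by
    intro q hq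
    refine ⟨continuousOn_pi.2 fun y r hr => (hq.forward s hs r hr x y).continuousWithinAt, ?_⟩
    intro r hr
    rw [hasDerivWithinAt_pi]
    intro y
    exact (hq.forward s hs r (Ico_subset_Icc_self hr) x y).mono_of_mem_nhdsWithin
      (mem_of_superset (Icc_mem_nhdsGE hr.2) (Icc_subset_Icc_left hr.1))
  obtain ⟨c1, d1⟩ := key p hp
  obtain ⟨c2, d2⟩ := key _ (isTransitionFunction_flipKernel lam τ)
  have := ODE_solution_unique_of_mem_Icc_right (v := fun _ => L) (s := fun _ => univ)
    (fun _ _ => L.lipschitz.lipschitzOnWith) c1 d1 (fun _ _ => mem_univ _) c2 d2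
    (fun _ _ => mem_univ _) (by
      ext y
      rw [hp.initial s hs, (isTransitionFunction_flipKernel lam τ).initial s hs])
  exact congrFun (this ht) y

end BitFlipControl

/-! ### A compactness principle for laws on product spaces -/

/-- Probability measures on a power of a finite discrete space have a limit point on cylinders. -/
theorem exists_isProbabilityMeasure_of_tendsto_cylinders {ι α κ : Type*} [MeasurableSpace α]
    [TopologicalSpace α] [DiscreteTopology α] [DiscreteMeasurableSpace α] [Finite α]
    {l : Filter κ} [NeBot l]
    (P : κ → Measure (ι → α)) [∀ k, IsProbabilityMeasure (P k)] :
    ∃ Q : Measure (ι → α), IsProbabilityMeasure Q ∧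
      ∀ S ∈ measurableCylinders (fun _ : ι => α), ∀ c,
        Tendsto (fun k => P k S) l (𝓝 c) → Q S = c := by
  -- Along an ultrafilter all the values converge at once, so no subsequence has to be chosen.
  let U : Ultrafilter κ := Ultrafilter.of l
  have hU : (U : Filter κ) ≤ l := Ultrafilter.of_le l
  have hlim : ∀ S : Set (ι → α), ∃ c, Tendsto (fun k => P k S) U (𝓝 c) := fun S =>
    ⟨(U.map fun k => P k S).lim, Ultrafilter.le_nhds_lim _⟩
  choose m hm using hlim
  have hC : IsSetRing (measurableCylinders fun _ : ι => α) := isSetRing_measurableCylinders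
  have hempty : m ∅ = 0 := tendsto_nhds_unique (hm ∅) (by simp)
  let M : AddContent ENNReal (measurableCylinders fun _ : ι => α) :=
    hC.addContent_of_union m hempty (by
      intro s t hs ht hst
      have := (hm s).add (hm t)
      refine tendsto_nhds_unique (hm (s ∪ t)) (this.congr fun k => ?_)
      rw [measure_union hst (MeasurableSet.of_mem_measurableCylinders ht)])
  have hM : ∀ s, M s = m s := fun _ => rfl
  have hle : ∀ s, m s ≤ 1 := fun s => le_of_tendsto' (hm s) fun k => prob_le_one
  -- Countable additivity reduces to continuity at ∅. Cylinders are closed in a compact product, so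
  -- a decreasing sequence of them with empty intersection is eventually empty.
  have hsub : M.IsSigmaSubadditive := by
    refine isSigmaSubadditive_of_addContent_iUnion_eq_tsum hC fun f hf hU hd => ?_
    refine addContent_iUnion_eq_sum_of_tendsto_zero hC M
      (fun s _ => ((hle s).trans_lt ENNReal.one_lt_top).ne) ?_ hf hU hd
    intro s hs hanti hinter
    have hclosed : ∀ n, IsClosed (s n) := by
      intro n
      obtain ⟨I, S, -, h⟩ := (mem_measurableCylinders _).1 (hs n)
      rw [h]
      exact IsClosed.cylinder I (isClosed_discrete S)
    have : ∃ n, s n = ∅ := by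
      by_contra! hne
      have := IsCompact.nonempty_iInter_of_sequence_nonempty_isCompact_isClosed s
        (fun i => hanti (Nat.le_succ i)) hne (hclosed 0).isCompact hclosed
      rw [hinter] at this
      exact this.ne_empty rfl
    obtain ⟨n, hn⟩ := this
    refine tendsto_const_nhds.congr' ?_
    filter_upwards [eventually_ge_atTop n] with k hk
    have : s k = ∅ := subset_empty_iff.1 (hn ▸ hanti hk)
    rw [hM, this, hempty]
  have hgen := (generateFrom_measurableCylinders (α := fun _ : ι => α)).symm
  have hQ : ∀ S ∈ measurableCylinders (fun _ : ι => α),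
      M.measure hC.isSetSemiring hgen.le hsub S = m S := fun S hS =>
    M.measure_eq hC.isSetSemiring hgen hsub hS
  refine ⟨M.measure hC.isSetSemiring hgen.le hsub, ⟨?_⟩, fun S hS c hc => ?_⟩
  · rw [hQ _ (univ_mem_measurableCylinders _)]
    exact tendsto_nhds_unique (hm univ) (by simp)
  · rw [hQ S hS]
    exact tendsto_nhds_unique (hm S) (hc.mono_left hU)

namespace BitFlipControl

variable {N : ℕ}

/-! ### Finite-dimensional distributions -/

/-- The trajectories which pass through the states `x` at the times `t`. -/
def pathCylinder {n : ℕ} (t : Fin n → unitInterval) (x : Fin n → State N) :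
    Set (Path N) := {X | ∀ k, X (t k) = x k}

/-- The probability of passing through the states `x` at the times `t`, for the chain with initial
distribution `μ₀` and transition function `p`. -/
def pathWeight (μ₀ : PMF (State N)) (p : ℝ → ℝ → State N → State N → ℝ) {n : ℕ}
    (t : Fin (n + 1) → unitInterval) (x : Fin (n + 1) → State N) : ℝ :=
  (μ₀ (x 0)).toReal * ∏ k : Fin n, p (t k.castSucc) (t k.succ) (x k.succ) (x k.castSucc)

lemma pathCylinder_mem_measurableCylinders {n : ℕ} (t : Fin n → unitInterval)
    (x : Fin n → State N) :
    pathCylinder t x ∈ measurableCylinders (fun _ : unitInterval => State N) := by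
  classical
  refine (mem_measurableCylinders _).2 ⟨Finset.univ.image t,
    {f | ∀ k, f ⟨t k, Finset.mem_image_of_mem t (Finset.mem_univ k)⟩ = x k},
    MeasurableSet.of_discrete, ?_⟩
  ext X
  simp [pathCylinder]

lemma measurableSet_pathCylinder {n : ℕ} (t : Fin n → unitInterval) (x : Fin n → State N) :
    MeasurableSet (pathCylinder t x) :=
  MeasurableSet.of_mem_measurableCylinders (pathCylinder_mem_measurableCylinders t x)

lemma measurableSet_eval_eq (t : unitInterval) (z : State N) :
    MeasurableSet {X : Path N | X t = z} :=
  (measurable_pi_apply (X := fun _ : unitInterval => State N) t) (measurableSet_singleton z)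

lemma pathCylinder_snoc {n : ℕ} (t : Fin n → unitInterval) (x : Fin n → State N)
    (s : unitInterval) (y : State N) :
    pathCylinder (Fin.snoc t s : Fin (n + 1) → unitInterval) (Fin.snoc x y : Fin (n + 1) → State N)
      = pathCylinder t x ∩ {X | X s = y} := by
  ext X
  simp [pathCylinder, Fin.forall_fin_succ']

lemma pathWeight_snoc (μ₀ : PMF (State N)) (p : ℝ → ℝ → State N → State N → ℝ) {n : ℕ}
    (t : Fin (n + 1) → unitInterval) (x : Fin (n + 1) → State N) (s : unitInterval) (y : State N) :
    pathWeight μ₀ p (Fin.snoc t s : Fin (n + 2) → unitInterval)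
      (Fin.snoc x y : Fin (n + 2) → State N)
      = pathWeight μ₀ p t x * p (t (Fin.last n)) s y (x (Fin.last n)) := by
  have h0 : ∀ {β : Type} (f : Fin (n + 1) → β) (b : β),
      (Fin.snoc f b : Fin (n + 2) → β) 0 = f 0 := fun f b => Fin.snoc_castSucc (i := 0) ..
  simp only [pathWeight, h0, Fin.prod_univ_castSucc (n := n), Fin.succ_last, Fin.snoc_last,
    Fin.snoc_castSucc, ← Fin.castSucc_succ, mul_assoc]

lemma monotone_snoc {n : ℕ} {t : Fin (n + 1) → unitInterval} (ht : Monotone t) {s : unitInterval}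
    (hs : t (Fin.last n) ≤ s) : Monotone (Fin.snoc t s : Fin (n + 2) → unitInterval) := by
  rw [Fin.monotone_iff_le_succ]
  intro i
  induction i using Fin.lastCases with
  | last => simpa [Fin.succ_last] using hs
  | cast i =>
    simp only [Fin.snoc_castSucc, ← Fin.castSucc_succ]
    exact ht (Fin.castSucc_le_succ i)

lemma snoc_zero {n : ℕ} (t : Fin (n + 1) → unitInterval) (s : unitInterval) :
    (Fin.snoc t s : Fin (n + 2) → unitInterval) 0 = t 0 := Fin.snoc_castSucc (i := 0) ..

/-- `Q` has the finite-dimensional distributions of the Markov chain at the times in `J`. -/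
def HasLawAt (μ₀ : PMF (State N)) (p : ℝ → ℝ → State N → State N → ℝ) (J : Set unitInterval)
    (Q : Measure (Path N)) : Prop :=
  ∀ (n : ℕ) (t : Fin (n + 1) → unitInterval) (x : Fin (n + 1) → State N),
    Monotone t → t 0 = 0 → (∀ k, t k ∈ J) → Q.real (pathCylinder t x) = pathWeight μ₀ p t x

lemma isChainLaw_iff {μ₀ : PMF (State N)} {u : Rates N} {Q : Measure (Path N)} :
    IsChainLaw μ₀ u Q ↔ IsProbabilityMeasure Q ∧
      ∃ p, IsTransitionFunction u p ∧ HasLawAt μ₀ p univ Q := by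
  simp [IsChainLaw, HasLawAt, pathCylinder, pathWeight]

lemma sum_measureReal_inter_eval (Q : Measure (Path N)) [IsFiniteMeasure Q] (s : unitInterval)
    (A : Set (Path N)) : ∑ z, Q.real (A ∩ {X | X s = z}) = Q.real A := by
  have h := sum_measureReal_preimage_singleton (μ := Q.restrict A) (f := fun X : Path N => X s)
    Finset.univ (fun z _ => measurableSet_eval_eq s z)
  simp only [Finset.coe_univ, preimage_univ] at h
  rw [measureReal_restrict_apply_univ] at h
  rw [← h]
  refine Finset.sum_congr rfl fun z _ => ?_
  rw [inter_comm]
  exact (measureReal_restrict_apply (measurableSet_eval_eq s z)).symm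

/-! ### Construction of the base chain -/

/-- Replace the trajectory from time `a` on by the constant `y`. -/
def freezeFrom (a : unitInterval) (y : State N) (X : Path N) : Path N :=
  fun t => if t < a then X t else y

lemma measurable_freezeFrom (a : unitInterval) (y : State N) :
    Measurable (freezeFrom a y : Path N → Path N) := by
  refine measurable_pi_lambda _ fun t => ?_
  by_cases h : t < a
  · simpa [freezeFrom, h] using measurable_pi_apply t
  · simp [freezeFrom, h]

/-- Prolong the law `Q`, known up to time `m`, by a transition with probabilities `q`, at time
`a`. -/
def prolong (Q : Measure (Path N)) (m a : unitInterval) (q : State N → State N → ℝ) :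
    Measure (Path N) :=
  ∑ y, ∑ z, ENNReal.ofReal (q y z) • (Q.restrict {X | X m = z}).map (freezeFrom a y)

lemma prolong_real_apply (Q : Measure (Path N)) [IsFiniteMeasure Q] (m a : unitInterval)
    {q : State N → State N → ℝ} (hq : ∀ y z, 0 ≤ q y z) {A : Set (Path N)} (hA : MeasurableSet A) :
    (prolong Q m a q).real A =
      ∑ y, ∑ z, q y z * Q.real (freezeFrom a y ⁻¹' A ∩ {X | X m = z}) := by
  have hne : ∀ y z, ENNReal.ofReal (q y z) * Q (freezeFrom a y ⁻¹' A ∩ {X | X m = z}) ≠ ⊤ :=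
    fun y z => ENNReal.mul_ne_top ENNReal.ofReal_ne_top (measure_ne_top _ _)
  simp only [measureReal_def, prolong, Measure.coe_finsetSum, Finset.sum_apply, Measure.smul_apply,
    smul_eq_mul]
  simp only [Measure.map_apply (measurable_freezeFrom a _) hA,
    Measure.restrict_apply (measurable_freezeFrom a _ hA)]
  rw [ENNReal.toReal_sum fun y _ => ENNReal.sum_ne_top.2 fun z _ => hne y z]
  refine Finset.sum_congr rfl fun y _ => ?_
  rw [ENNReal.toReal_sum fun z _ => hne y z]
  refine Finset.sum_congr rfl fun z _ => ?_
  rw [ENNReal.toReal_mul, ENNReal.toReal_ofReal (hq y z)]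

lemma freezeFrom_preimage_of_lt {n : ℕ} {t : Fin n → unitInterval} {x : Fin n → State N}
    {a : unitInterval} (h : ∀ k, t k < a) (y : State N) :
    freezeFrom a y ⁻¹' pathCylinder t x = pathCylinder t x := by
  ext X
  simp [pathCylinder, freezeFrom, h]

/-- Prolonging a law of the chain adds a time to the times at which it is correct. -/
lemma HasLawAt.prolong {μ₀ : PMF (State N)} {ρ : ℝ} (hρ : 0 < ρ) {J : Set unitInterval}
    {Q : Measure (Path N)} [IsProbabilityMeasure Q]
    (hQ : HasLawAt μ₀ (fun s t => flipKernel ρ (t - s)) J Q) {m a : unitInterval} (hm : m ∈ J)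
    (hJ : ∀ s ∈ J, s ≤ m) (ha : m < a) :
    IsProbabilityMeasure (prolong Q m a (flipKernel ρ (a - m))) ∧
      HasLawAt μ₀ (fun s t => flipKernel ρ (t - s)) (insert a J)
        (prolong Q m a (flipKernel ρ (a - m))) := by
  have hr : (0 : ℝ) ≤ a - m := sub_nonneg.2 ha.le
  have hpos := flipKernel_nonneg (N := N) hρ hr
  -- Events that freezing does not affect keep their probability, because the transition
  -- probabilities out of each state sum to one.
  have hfree : ∀ A, MeasurableSet A → (∀ y, freezeFrom a y ⁻¹' A = A) →
      (BitFlipControl.prolong Q m a (flipKernel ρ (a - m))).real A = Q.real A := by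
    intro A hA h
    rw [prolong_real_apply Q m a hpos hA, Finset.sum_comm]
    simp only [h, ← Finset.sum_mul, sum_flipKernel, one_mul]
    exact sum_measureReal_inter_eval Q m A
  refine ⟨⟨?_⟩, ?_⟩
  · have := hfree univ MeasurableSet.univ (fun _ => preimage_univ)
    rw [measureReal_def, measureReal_def, measure_univ (μ := Q), ENNReal.toReal_one] at this
    exact (ENNReal.toReal_eq_one_iff _).1 this
  have hlow : ∀ (n : ℕ) (t : Fin (n + 1) → unitInterval), Monotone t → (∀ k, t k ∈ insert a J) →
      t (Fin.last n) ≠ a → (∀ k, t k ∈ J) ∧ ∀ k, t k < a := by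
    intro n t ht htJ hne
    have h1 : t (Fin.last n) < a :=
      (hJ _ ((htJ _).resolve_left hne)).trans_lt ha
    have h2 : ∀ k, t k < a := fun k => (ht (Fin.le_last k)).trans_lt h1
    exact ⟨fun k => (htJ k).resolve_left (h2 k).ne, h2⟩
  intro n
  induction n with
  | zero =>
    intro t x ht ht0 htJ
    have hne : t (Fin.last 0) ≠ a := by
      rw [show Fin.last 0 = 0 from rfl, ht0]
      exact (lt_of_le_of_lt (show (0 : unitInterval) ≤ m from m.2.1) ha).ne
    obtain ⟨h1, h2⟩ := hlow 0 t ht htJ hne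
    rw [hfree _ (measurableSet_pathCylinder t x) (freezeFrom_preimage_of_lt h2)]
    exact hQ 0 t x ht ht0 h1
  | succ n ih =>
    intro t x ht ht0 htJ
    by_cases hlast : t (Fin.last (n + 1)) = a
    swap
    · obtain ⟨h1, h2⟩ := hlow _ t ht htJ hlast
      rw [hfree _ (measurableSet_pathCylinder t x) (freezeFrom_preimage_of_lt h2)]
      exact hQ _ t x ht ht0 h1
    obtain ⟨t', s, rfl⟩ : ∃ t' s, t = (Fin.snoc t' s : Fin (n + 2) → unitInterval) :=
      ⟨Fin.init t, _, (Fin.snoc_init_self t).symm⟩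
    obtain ⟨x', y, rfl⟩ : ∃ x' y, x = (Fin.snoc x' y : Fin (n + 2) → State N) :=
      ⟨Fin.init x, _, (Fin.snoc_init_self x).symm⟩
    rw [Fin.snoc_last] at hlast
    subst hlast
    rw [snoc_zero] at ht0
    have ht' : Monotone t' := fun i j hij => by
      simpa using ht (Fin.castSucc_le_castSucc_iff.2 hij)
    have htJ' : ∀ k, t' k ∈ insert s J := fun k => by simpa using htJ k.castSucc
    rw [pathWeight_snoc]
    -- The new time may occur repeatedly in a monotone tuple. A repetition contributes the kernel at
    -- time zero, a Kronecker delta, and the induction hypothesis handles the shorter tuple.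
    by_cases hlast' : t' (Fin.last n) = s
    · rw [hlast', sub_self, flipKernel_zero, pathCylinder_snoc]
      split_ifs with hy
      · rw [mul_one, ← ih t' x' ht' ht0 htJ', inter_eq_left.2]
        intro X hX
        rw [mem_ofPred_eq, hy, ← hX, hlast']
      · have : pathCylinder t' x' ∩ {X | X s = y} = ∅ := by
          rw [← disjoint_iff_inter_eq_empty, disjoint_left]
          intro X hX hX'
          apply hy
          rw [← hX (Fin.last n), hlast']
          exact hX'.symm
        rw [this, mul_zero]
        simp
    · obtain ⟨h1, h2⟩ := hlow n t' ht' htJ' hlast'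
      have hpre : ∀ y', freezeFrom s y' ⁻¹' (pathCylinder t' x' ∩ {X | X s = y}) =
          if y' = y then pathCylinder t' x' else ∅ := by
        intro y'
        rw [preimage_inter, freezeFrom_preimage_of_lt h2]
        split_ifs with h
        · simp [freezeFrom, h]
        · simp [freezeFrom, h]
      have hsum : ∀ z, Q.real (pathCylinder t' x' ∩ {X | X m = z}) =
          pathWeight μ₀ (fun s t => flipKernel ρ (t - s)) t' x' *
            flipKernel ρ (m - t' (Fin.last n)) z (x' (Fin.last n)) := by
        intro z
        rw [← pathCylinder_snoc, hQ _ _ _ (monotone_snoc ht' (hJ _ (h1 _)))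
          (by rw [snoc_zero, ht0]), pathWeight_snoc]
        intro k
        induction k using Fin.lastCases with
        | last => simpa using hm
        | cast i => simpa using h1 i
      rw [pathCylinder_snoc, prolong_real_apply Q m s hpos
        ((measurableSet_pathCylinder _ _).inter (measurableSet_eval_eq _ _)),
        Finset.sum_eq_single y]
      · simp only [hpre, if_true, hsum]
        -- The passage through time `m` is summed out by Chapman–Kolmogorov.
        rw [show (s - t' (Fin.last n) : ℝ) = (m - t' (Fin.last n)) + (s - m) by ring,
          ← sum_flipKernel_mul, Finset.mul_sum]
        exact Finset.sum_congr rfl fun z _ => by ring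
      · intro y' _ hy'
        simp [hpre, hy']
      · simp

/-- The trajectories which are constant, with the initial distribution `μ₀`. -/
lemma exists_hasLawAt_zero (μ₀ : PMF (State N)) (ρ : ℝ) :
    ∃ Q : Measure (Path N), IsProbabilityMeasure Q ∧
      HasLawAt μ₀ (fun s t => flipKernel ρ (t - s)) {0} Q := by
  have hmeas : Measurable (fun (x : State N) (_ : unitInterval) => x) :=
    measurable_pi_lambda _ fun _ => measurable_id
  refine ⟨μ₀.toMeasure.map fun x _ => x,
    Measure.isProbabilityMeasure_map hmeas.aemeasurable, ?_⟩
  intro n t x _ _ htJ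
  rw [measureReal_def, Measure.map_apply hmeas (measurableSet_pathCylinder t x)]
  simp only [mem_singleton_iff] at htJ
  simp only [pathWeight, htJ, sub_self, flipKernel_zero]
  by_cases h : ∀ k, x k = x 0
  · have : (fun (x : State N) (_ : unitInterval) => x) ⁻¹' pathCylinder t x = {x 0} := by
      ext z
      simp only [pathCylinder, mem_preimage, mem_ofPred_eq, mem_singleton_iff]
      exact ⟨fun hz => hz 0, fun hz k => by rw [h k, hz]⟩
    rw [this, PMF.toMeasure_apply_singleton _ _ (measurableSet_singleton _)]
    simp [h]
  · have : (fun (x : State N) (_ : unitInterval) => x) ⁻¹' pathCylinder t x = ∅ := by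
      ext z
      simp only [pathCylinder, mem_preimage, mem_ofPred_eq, mem_empty_iff_false, iff_false]
      exact fun hz => h fun k => by rw [← hz k, ← hz 0]
    rw [this]
    have : ∃ k : Fin n, x k.succ ≠ x k.castSucc := by
      by_contra! hc
      exact h fun k => by
        induction k using Fin.induction with
        | zero => rfl
        | succ i hi => rw [hc, hi]
    obtain ⟨k, hk⟩ := this
    rw [Finset.prod_eq_zero (Finset.mem_univ k) (if_neg hk)]
    simp

lemma exists_hasLawAt_finset (μ₀ : PMF (State N)) {ρ : ℝ} (hρ : 0 < ρ) (J : Finset unitInterval) :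
    ∃ Q : Measure (Path N), IsProbabilityMeasure Q ∧
      HasLawAt μ₀ (fun s t => flipKernel ρ (t - s)) (insert 0 (J : Set unitInterval)) Q := by
  induction J using Finset.induction_on_max with
  | empty => simpa using exists_hasLawAt_zero μ₀ ρ
  | insert a s hs ih =>
    obtain ⟨Q, hQ, hlaw⟩ := ih
    by_cases ha : a = 0
    · subst ha
      exact ⟨Q, hQ, by simpa using hlaw⟩
    have ha' : 0 < a := unitInterval.pos_iff_ne_zero.2 ha
    obtain ⟨m, hm, hmax⟩ := (insert 0 s).exists_max_image id (Finset.insert_nonempty _ _)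
    have hma : m < a := by
      rcases Finset.mem_insert.1 hm with rfl | h
      exacts [ha', hs m h]
    have := hlaw.prolong hρ (m := m) (by simpa using hm) (fun r hr => hmax r (by simpa using hr)) hma
    refine ⟨_, this.1, ?_⟩
    rw [Finset.coe_insert, insert_comm]
    exact this.2

/-- Existence of the base chain. -/
theorem exists_isChainLaw_baseRates (μ₀ : PMF (State N)) (lam τ : ℝ) :
    ∃ P : Measure (Path N), IsChainLaw μ₀ (baseRates N lam τ) P := by
  choose Q hQ hlaw using exists_hasLawAt_finset μ₀ (baseRate_pos lam τ)
  obtain ⟨P, hP, hlim⟩ := exists_isProbabilityMeasure_of_tendsto_cylinders (l := atTop) Q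
  refine ⟨P, isChainLaw_iff.2 ⟨hP, _, isTransitionFunction_flipKernel lam τ, ?_⟩⟩
  intro n t x ht ht0 _
  -- As soon as `J` contains all the times of the cylinder, its probability is exactly the chain
  -- weight, so the limit is that of an eventually constant net.
  have hw : ∀ᶠ J in atTop, Q J (pathCylinder t x) = ENNReal.ofReal
      (pathWeight μ₀ (fun s t => flipKernel (baseRate lam τ) (t - s)) t x) := by
    classical
    filter_upwards [eventually_ge_atTop (Finset.univ.image t)] with J hJ
    rw [← hlaw J n t x ht ht0 fun k => Or.inr (hJ (Finset.mem_image_of_mem t (Finset.mem_univ k))),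
      ofReal_measureReal]
  have h0 : 0 ≤ pathWeight μ₀ (fun s t => flipKernel (baseRate lam τ) (t - s)) t x := by
    refine mul_nonneg ENNReal.toReal_nonneg (Finset.prod_nonneg fun k _ => ?_)
    exact flipKernel_nonneg (baseRate_pos lam τ)
      (sub_nonneg.2 (ht (Fin.castSucc_le_succ k))) _ _
  rw [measureReal_def, hlim _ (pathCylinder_mem_measurableCylinders t x) _
    (tendsto_const_nhds.congr' (hw.mono fun _ h => h.symm)), ENNReal.toReal_ofReal h0]

end BitFlipControl

/-! ### Exponential tilting and relative entropy -/

section Tilting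

open InformationTheory

variable {Ω : Type*} [MeasurableSpace Ω] {P Q : Measure Ω} [IsProbabilityMeasure P] {f : Ω → ℝ}

lemma integrable_exp_of_abs_le (hf : Measurable f) {C : ℝ} (hC : ∀ ω, |f ω| ≤ C) :
    Integrable (fun ω => Real.exp (f ω)) P := by
  refine Integrable.of_bound (Real.measurable_exp.comp hf).aestronglyMeasurable
    (Real.exp C) (ae_of_all _ fun ω => ?_)
  rw [Real.norm_eq_abs, Real.abs_exp, Real.exp_le_exp]
  exact (le_abs_self _).trans (hC ω)

lemma klDiv_tilted_self_ne_top (hf : Measurable f) {C : ℝ} (hC : ∀ ω, |f ω| ≤ C) :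
    klDiv (P.tilted f) P ≠ ⊤ := by
  have hexp := integrable_exp_of_abs_le (P := P) hf hC
  have := isProbabilityMeasure_tilted hexp
  have hac := tilted_absolutelyContinuous P f
  refine klDiv_ne_top hac ?_
  have h : llr (P.tilted f) P =ᵐ[P] fun ω => f ω - Real.log (∫ z, Real.exp (f z) ∂P) := by
    filter_upwards [llr_tilted_left (Measure.AbsolutelyContinuous.refl P) hexp hf.aemeasurable,
      llr_self P] with ω h1 h2
    rw [h1, h2]; simp
  rw [integrable_congr (hac.ae_le h)]
  exact (Integrable.of_bound hf.aestronglyMeasurable C (ae_of_all _ hC)).sub (integrable_const _)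

/-- Changing the reference measure subtracts `f` from the log-likelihood ratio and adds the
log-partition function; boundedness of `f` keeps everything integrable. -/
lemma klDiv_tilted_right [IsProbabilityMeasure Q] (hf : Measurable f) {C : ℝ}
    (hC : ∀ ω, |f ω| ≤ C) (h : klDiv Q P ≠ ⊤) :
    klDiv Q (P.tilted f) ≠ ⊤ ∧ (klDiv Q (P.tilted f)).toReal =
      (klDiv Q P).toReal - ∫ ω, f ω ∂Q + Real.log (∫ ω, Real.exp (f ω) ∂P) := by
  have hexp := integrable_exp_of_abs_le (P := P) hf hC
  have := isProbabilityMeasure_tilted hexp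
  obtain ⟨hac, hint⟩ := klDiv_ne_top_iff.1 h
  have hfQ : Integrable f Q := Integrable.of_bound hf.aestronglyMeasurable C (ae_of_all _ hC)
  have hac' : Q ≪ P.tilted f := hac.trans (absolutelyContinuous_tilted hexp)
  refine ⟨klDiv_ne_top hac' (integrable_llr_tilted_right hac hfQ hint hexp), ?_⟩
  rw [toReal_klDiv_of_measure_eq hac' (by simp), toReal_klDiv_of_measure_eq hac (by simp),
    integral_llr_tilted_right hac hfQ hexp hint]

end Tilting

namespace BitFlipControl

variable {N : ℕ}

/-! ### Doob transforms -/

/-- The Doob transform of the rates `Q` by the space-time function `h`. -/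
def doobRates (Q : Rates N) (h : ℝ → State N → ℝ) : Rates N := fun t y x =>
  Q t y x * h t y / h t x - if y = x then (∑ z, Q t z x * h t z) / h t x else 0

lemma doobRates_of_ne (Q : Rates N) (h : ℝ → State N → ℝ) (t : ℝ) {y x : State N} (hne : y ≠ x) :
    doobRates Q h t y x = Q t y x * h t y / h t x := by simp [doobRates, hne]

/-- The diagonal correction in `doobRates` is what makes the total outflow vanish; no equation for
`h` is needed here. -/
lemma isAdmissible_doobRates {Q : Rates N} (hQ : IsAdmissible Q) {h : ℝ → State N → ℝ}
    (hpos : ∀ t ∈ Icc (0 : ℝ) 1, ∀ x, 0 < h t x)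
    (hc : ∀ x, ContinuousOn (fun t => h t x) (Icc (0 : ℝ) 1)) :
    IsAdmissible (doobRates Q h) where
  nonneg t ht x y hne := by
    rw [doobRates_of_ne _ _ _ hne]
    exact div_nonneg (mul_nonneg (hQ.nonneg t ht x y hne) (hpos t ht y).le) (hpos t ht x).le
  single_flip t ht x y hd := by
    have hne : y ≠ x := by rintro rfl; simp at hd
    rw [doobRates_of_ne _ _ _ hne, hQ.single_flip t ht x y hd, zero_mul, zero_div]
  diag t ht x := by
    have hx := (hpos t ht x).ne'
    have : ∑ y ∈ Finset.univ.erase x, doobRates Q h t y x =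
        ∑ y ∈ Finset.univ.erase x, Q t y x * h t y / h t x :=
      Finset.sum_congr rfl fun y hy => doobRates_of_ne _ _ _ (Finset.ne_of_mem_erase hy)
    rw [this, ← Finset.sum_div]
    simp only [doobRates, if_true]
    rw [← Finset.add_sum_erase _ _ (Finset.mem_univ x)]
    field_simp
    ring
  continuous x y := by
    have hx : ∀ t ∈ Icc (0 : ℝ) 1, h t x ≠ 0 := fun t ht => (hpos t ht x).ne'
    refine (((hQ.continuous x y).mul (hc y)).div (hc x) hx).sub ?_
    split_ifs
    · exact (continuousOn_finsetSum _ fun z _ => (hQ.continuous x z).mul (hc z)).div (hc x) hx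
    · exact continuousOn_const

/-- The backward equation `hd` enters through the product rule: the time derivative of `h` supplies
exactly the diagonal correction of `doobRates`. -/
lemma isTransitionFunction_doobRates {Q : Rates N} {p : ℝ → ℝ → State N → State N → ℝ}
    (hp : IsTransitionFunction Q p) {h : ℝ → State N → ℝ}
    (hpos : ∀ t ∈ Icc (0 : ℝ) 1, ∀ x, 0 < h t x)
    (hd : ∀ t ∈ Icc (0 : ℝ) 1, ∀ x,
      HasDerivWithinAt (fun r => h r x) (-∑ z, Q t z x * h t z) (Icc 0 1) t) :
    IsTransitionFunction (doobRates Q h) (fun s t y x => p s t y x * h t y / h s x) where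
  initial s hs x y := by
    rw [hp.initial s hs]
    split_ifs with hyx
    · rw [hyx, one_mul, div_self (hpos s hs x).ne']
    · simp
  forward s hs t ht x y := by
    have ht' : t ∈ Icc (0 : ℝ) 1 := ⟨hs.1.trans ht.1, ht.2⟩
    have h1 := hp.forward s hs t ht x y
    have h2 := (hd t ht' y).mono (Icc_subset_Icc_left hs.1)
    refine ((h1.mul h2).div_const (h s x)).congr_deriv ?_
    have hs' := (hpos s hs x).ne'
    have hz : ∀ z, doobRates Q h t y z * (p s t z x * h t z / h s x) =
        (Q t y z * p s t z x * h t y -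
          if y = z then p s t y x * ∑ w, Q t w y * h t w else 0) / h s x := by
      intro z
      have := (hpos t ht' z).ne'
      by_cases hyz : y = z
      · subst hyz
        simp only [doobRates, if_true]
        field_simp
      · simp only [doobRates, hyz, if_false]
        field_simp
        ring
    rw [Finset.sum_congr rfl fun z _ => hz z, ← Finset.sum_div, Finset.sum_sub_distrib,
      Finset.sum_ite_eq, Finset.sum_mul]
    simp only [Finset.mem_univ, if_true]
    ring

/-- The ratios of `h` telescope along the path. -/
lemma pathWeight_doob (μ₀ : PMF (State N)) (p : ℝ → ℝ → State N → State N → ℝ)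
    {h : ℝ → State N → ℝ} (hpos : ∀ t ∈ Icc (0 : ℝ) 1, ∀ x, 0 < h t x) :
    ∀ {n : ℕ} (t : Fin (n + 1) → unitInterval) (x : Fin (n + 1) → State N),
      pathWeight μ₀ (fun s t y x => p s t y x * h t y / h s x) t x =
        pathWeight μ₀ p t x * h (t (Fin.last n)) (x (Fin.last n)) / h (t 0) (x 0) := by
  intro n
  induction n with
  | zero =>
    intro t x
    have := (hpos _ (t 0).2 (x 0)).ne'
    simp only [pathWeight, Fin.last_zero]
    rw [mul_div_cancel_right₀ _ this]
    simp
  | succ n ih =>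
    intro t x
    obtain ⟨t', s, rfl⟩ : ∃ t' s, t = (Fin.snoc t' s : Fin (n + 2) → unitInterval) :=
      ⟨Fin.init t, _, (Fin.snoc_init_self t).symm⟩
    obtain ⟨x', y, rfl⟩ : ∃ x' y, x = (Fin.snoc x' y : Fin (n + 2) → State N) :=
      ⟨Fin.init x, _, (Fin.snoc_init_self x).symm⟩
    have h0 : (Fin.snoc x' y : Fin (n + 2) → State N) 0 = x' 0 := Fin.snoc_castSucc (i := 0) ..
    rw [pathWeight_snoc, pathWeight_snoc, ih, Fin.snoc_last, Fin.snoc_last, snoc_zero, h0]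
    have := (hpos _ (t' (Fin.last n)).2 (x' (Fin.last n))).ne'
    have := (hpos _ (t' 0).2 (x' 0)).ne'
    field_simp

lemma measurable_comp_eval {E : Type*} [MeasurableSpace E] (t : unitInterval) (F : State N → E) :
    Measurable (fun X : Path N => F (X t)) :=
  (measurable_of_finite F).comp (measurable_pi_apply (X := fun _ : unitInterval => State N) t)

lemma integrable_comp_eval (Q : Measure (Path N)) [IsFiniteMeasure Q] (t : unitInterval)
    (F : State N → ℝ) : Integrable (fun X : Path N => F (X t)) Q := by
  refine Integrable.of_bound (measurable_comp_eval t F).aestronglyMeasurable (∑ z, |F z|)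
    (ae_of_all _ fun X => ?_)
  exact Finset.single_le_sum (f := fun z => |F z|) (fun _ _ => abs_nonneg _) (Finset.mem_univ _)

lemma integral_comp_eval (Q : Measure (Path N)) [IsFiniteMeasure Q] (t : unitInterval)
    (F : State N → ℝ) : ∫ X, F (X t) ∂Q = ∑ z, F z * Q.real {X | X t = z} := by
  have hm := (measurable_pi_apply (X := fun _ : unitInterval => State N) t)
  have : IsFiniteMeasure (Q.map fun X : Path N => X t) := inferInstance
  rw [← integral_map (μ := Q) (φ := fun X : Path N => X t) (f := F) hm.aemeasurable
    (measurable_of_finite F).aestronglyMeasurable, integral_fintype (Integrable.of_finite)]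
  refine Finset.sum_congr rfl fun z _ => ?_
  rw [smul_eq_mul, mul_comm, map_measureReal_apply hm (measurableSet_singleton z)]
  rfl

lemma setIntegral_comp_eval (Q : Measure (Path N)) [IsFiniteMeasure Q] (t : unitInterval)
    (F : State N → ℝ) (A : Set (Path N)) :
    ∫ X in A, F (X t) ∂Q = ∑ z, F z * Q.real (A ∩ {X | X t = z}) := by
  rw [integral_comp_eval]
  refine Finset.sum_congr rfl fun z _ => ?_
  rw [measureReal_restrict_apply (measurableSet_eval_eq t z), inter_comm]

lemma HasLawAt.initial {μ₀ : PMF (State N)} {p : ℝ → ℝ → State N → State N → ℝ}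
    {Q : Measure (Path N)} (hQ : HasLawAt μ₀ p univ Q) (z : State N) :
    Q.real {X | X 0 = z} = (μ₀ z).toReal := by
  have := hQ 0 (fun _ => 0) (fun _ => z) monotone_const rfl (fun _ => mem_univ _)
  simpa [pathCylinder, pathWeight] using this

lemma sum_pmf_toReal (μ₀ : PMF (State N)) : ∑ z, (μ₀ z).toReal = 1 := by
  rw [← ENNReal.toReal_sum fun z _ => PMF.apply_ne_top μ₀ z]
  have := μ₀.tsum_coe
  rw [tsum_fintype] at this
  simp [this]

/-- The logarithmic density of the Doob transform of a chain. -/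
def doobLogDensity (e h₀ : State N → ℝ) (X : Path N) : ℝ := Real.log (e (X 1)) - Real.log (h₀ (X 0))

lemma measurable_doobLogDensity (e h₀ : State N → ℝ) : Measurable (doobLogDensity e h₀) :=
  (measurable_comp_eval 1 fun z => Real.log (e z)).sub
    (measurable_comp_eval 0 fun z => Real.log (h₀ z))

lemma exists_abs_doobLogDensity_le (e h₀ : State N → ℝ) : ∃ C, ∀ X, |doobLogDensity e h₀ X| ≤ C := by
  refine ⟨∑ z, |Real.log (e z)| + ∑ z, |Real.log (h₀ z)|, fun X => (abs_sub _ _).trans ?_⟩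
  exact add_le_add
    (Finset.single_le_sum (f := fun z => |Real.log (e z)|) (fun _ _ => abs_nonneg _)
      (Finset.mem_univ _))
    (Finset.single_le_sum (f := fun z => |Real.log (h₀ z)|) (fun _ _ => abs_nonneg _)
      (Finset.mem_univ _))

/-- Tilting the law of a chain by a function of the terminal state is a Doob transform. -/
lemma HasLawAt.tilted {μ₀ : PMF (State N)} {p : ℝ → ℝ → State N → State N → ℝ}
    {P : Measure (Path N)} [IsProbabilityMeasure P] (hP : HasLawAt μ₀ p univ P)
    {e : State N → ℝ} {h : ℝ → State N → ℝ} (he : ∀ y, 0 < e y)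
    (hpos : ∀ t ∈ Icc (0 : ℝ) 1, ∀ x, 0 < h t x)
    (hh : ∀ t ∈ Icc (0 : ℝ) 1, ∀ x, h t x = ∑ y, p t 1 y x * e y) :
    ∫ X, Real.exp (doobLogDensity e (h 0) X) ∂P = 1 ∧
      HasLawAt μ₀ (fun s t y x => p s t y x * h t y / h s x) univ
        (P.tilted (doobLogDensity e (h 0))) := by
  have h00 : ∀ x, 0 < h 0 x := hpos 0 ⟨le_rfl, zero_le_one⟩
  have hexp : ∀ X : Path N, Real.exp (doobLogDensity e (h 0) X) = e (X 1) / h 0 (X 0) := by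
    intro X
    rw [doobLogDensity, Real.exp_sub, Real.exp_log (he _), Real.exp_log (h00 _)]
  -- On a cylinder starting at time 0 the factor at X_0 is constant. Appending the time 1 and
  -- summing over the terminal state turns `e` into `h` at the last time, by `hh`.
  have key : ∀ (n : ℕ) (t : Fin (n + 1) → unitInterval) (x : Fin (n + 1) → State N),
      Monotone t → t 0 = 0 →
      ∫ X in pathCylinder t x, Real.exp (doobLogDensity e (h 0) X) ∂P =
        pathWeight μ₀ (fun s t y x => p s t y x * h t y / h s x) t x := by
    intro n t x ht ht0
    have hcongr : ∫ X in pathCylinder t x, Real.exp (doobLogDensity e (h 0) X) ∂P =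
        ∫ X in pathCylinder t x, (fun z => e z / h 0 (x 0)) (X 1) ∂P := by
      refine setIntegral_congr_fun (measurableSet_pathCylinder t x) fun X hX => ?_
      have : X 0 = x 0 := by rw [← hX 0, ht0]
      simp only [hexp, this]
    rw [hcongr, setIntegral_comp_eval P 1 (fun z => e z / h 0 (x 0)), pathWeight_doob μ₀ p hpos, ht0, Icc.coe_zero,
      hh _ (t (Fin.last n)).2, Finset.mul_sum, Finset.sum_div]
    refine Finset.sum_congr rfl fun z _ => ?_
    rw [← pathCylinder_snoc, hP _ _ _ (monotone_snoc ht (t (Fin.last n)).2.2)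
      (by rw [snoc_zero, ht0]) (fun _ => mem_univ _), pathWeight_snoc, Icc.coe_one]
    ring
  have hint : Integrable (fun X => Real.exp (doobLogDensity e (h 0) X)) P := by
    obtain ⟨C, hC⟩ := exists_abs_doobLogDensity_le e (h 0)
    exact integrable_exp_of_abs_le (measurable_doobLogDensity e (h 0)) hC
  -- Already conditionally on X_0 the density has mean one, so the total mass is that of μ₀.
  have hone : ∫ X, Real.exp (doobLogDensity e (h 0) X) ∂P = 1 := by
    have hU : (⋃ z ∈ (Finset.univ : Finset (State N)), {X : Path N | X 0 = z}) = univ := by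
      ext X; simp
    rw [← setIntegral_univ, ← hU, integral_biUnion_finset _
      (fun z _ => measurableSet_eval_eq 0 z) _ (fun z _ => hint.integrableOn),
      ← sum_pmf_toReal μ₀]
    · refine Finset.sum_congr rfl fun z _ => ?_
      have := key 0 (fun _ => 0) (fun _ => z) monotone_const rfl
      simpa [pathCylinder, pathWeight] using this
    · intro z _ w _ hzw
      exact disjoint_left.2 fun X (hX : X 0 = z) (hX' : X 0 = w) => hzw (hX ▸ hX')
  refine ⟨hone, fun n t x ht ht0 _ => ?_⟩
  rw [← key n t x ht ht0, measureReal_def, tilted_apply_eq_ofReal_integral, hone]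
  simp only [div_one]
  rw [ENNReal.toReal_ofReal]
  exact integral_nonneg fun _ => (Real.exp_pos _).le

/-! ### The optimal control and its law -/

lemma isAdmissible_baseRates (lam τ : ℝ) : IsAdmissible (baseRates N lam τ) where
  nonneg t _ x y h := baseRates_nonneg lam τ t h
  single_flip t _ x y h := baseRates_eq_zero lam τ t (by rwa [hammingDist_comm])
  diag t _ x := by
    have := sum_baseRates lam τ t x
    rw [← Finset.add_sum_erase _ _ (Finset.mem_univ x)] at this
    linarith
  continuous x y := continuousOn_const

/-- The desirability function: the conditional expectation under the base chain of
`exp (-g(X_1) / τ)`, given that `X_t = x`. -/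
def desirability (g : State N → ℝ) (lam τ t : ℝ) (x : State N) : ℝ :=
  ∑ y, flipKernel (baseRate lam τ) (1 - t) y x * Real.exp (-g y / τ)

lemma desirability_pos (g : State N → ℝ) (lam τ : ℝ) {t : ℝ} (ht : t ≤ 1) (x : State N) :
    0 < desirability g lam τ t x := by
  refine Finset.sum_pos' (fun y _ => ?_) ⟨x, Finset.mem_univ x, ?_⟩
  · exact mul_nonneg (flipKernel_nonneg (baseRate_pos lam τ) (by linarith) _ _) (Real.exp_pos _).le
  · exact mul_pos (flipKernel_self_pos _ _ _) (Real.exp_pos _)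

/-- This is the backward equation; it follows from the forward one since kernel and rates are
symmetric and time enters as 1 - t. -/
lemma hasDerivAt_desirability (g : State N → ℝ) (lam τ t : ℝ) (x : State N) :
    HasDerivAt (fun r => desirability g lam τ r x)
      (-∑ z, baseRates N lam τ t z x * desirability g lam τ t z) t := by
  have h : ∀ y, HasDerivAt
      (fun r => flipKernel (baseRate lam τ) (1 - r) y x * Real.exp (-g y / τ))
      (-(∑ z, baseRates N lam τ t z x * flipKernel (baseRate lam τ) (1 - t) y z) *
        Real.exp (-g y / τ)) t := by
    intro y
    have h1 := (hasDerivAt_flipKernel lam τ t (1 - t) x y).comp t ((hasDerivAt_id t).const_sub 1)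
    simp only [Function.comp_def, mul_neg, mul_one] at h1
    simp only [flipKernel_comm _ _ y, ← baseRates_comm lam τ t x]
    exact h1.mul_const _
  unfold desirability
  refine (HasDerivAt.fun_sum fun y _ => h y).congr_deriv ?_
  simp only [Finset.mul_sum, Finset.sum_mul, neg_mul, Finset.sum_neg_distrib]
  rw [Finset.sum_comm]
  simp only [mul_assoc]

/-- The rates of the optimal control. -/
def optimalRates (g : State N → ℝ) (lam τ : ℝ) : Rates N :=
  doobRates (baseRates N lam τ) (desirability g lam τ)

/-- The transition function of the optimally controlled chain. -/
def optimalKernel (g : State N → ℝ) (lam τ s t : ℝ) (y x : State N) : ℝ :=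
  flipKernel (baseRate lam τ) (t - s) y x * desirability g lam τ t y / desirability g lam τ s x

lemma optimalKernel_pos (g : State N → ℝ) (lam τ : ℝ) {s t : ℝ} (hst : s < t) (ht : t ≤ 1)
    (y x : State N) : 0 < optimalKernel g lam τ s t y x :=
  div_pos (mul_pos (flipKernel_pos (baseRate_pos lam τ) (sub_pos.2 hst) _ _)
    (desirability_pos g lam τ ht y)) (desirability_pos g lam τ (hst.le.trans ht) x)

lemma isAdmissible_optimalRates (g : State N → ℝ) (lam τ : ℝ) :
    IsAdmissible (optimalRates g lam τ) :=
  isAdmissible_doobRates (isAdmissible_baseRates lam τ)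
    (fun _ ht x => desirability_pos g lam τ ht.2 x)
    (fun x t _ => (hasDerivAt_desirability g lam τ t x).continuousAt.continuousWithinAt)

lemma isTransitionFunction_optimalKernel (g : State N → ℝ) (lam τ : ℝ) :
    IsTransitionFunction (optimalRates g lam τ) (optimalKernel g lam τ) :=
  isTransitionFunction_doobRates (isTransitionFunction_flipKernel lam τ)
    (fun _ ht x => desirability_pos g lam τ ht.2 x)
    (fun t _ x => (hasDerivAt_desirability g lam τ t x).hasDerivWithinAt)

/-- A chain law comes with an unspecified transition function; uniqueness for the forward equation
identifies it with the explicit kernel. -/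
lemma IsChainLaw.hasLawAt_flipKernel {μ₀ : PMF (State N)} {lam τ : ℝ} {P : Measure (Path N)}
    (hP : IsChainLaw μ₀ (baseRates N lam τ) P) :
    HasLawAt μ₀ (fun s t => flipKernel (baseRate lam τ) (t - s)) univ P := by
  obtain ⟨-, p, hp, hlaw⟩ := isChainLaw_iff.1 hP
  intro n t x ht ht0 hJ
  rw [hlaw n t x ht ht0 hJ]
  unfold pathWeight
  congr 1
  refine Finset.prod_congr rfl fun k _ => ?_
  exact hp.eq_flipKernel (t k.castSucc).2 ⟨ht (Fin.castSucc_le_succ k), (t k.succ).2.2⟩ _ _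

/-- The law of the optimally controlled chain, as a tilting of the law `P` of the base chain. -/
def optimalLaw (g : State N → ℝ) (lam τ : ℝ) (P : Measure (Path N)) : Measure (Path N) :=
  P.tilted (doobLogDensity (fun y => Real.exp (-g y / τ)) (desirability g lam τ 0))

lemma IsChainLaw.optimalLaw_spec {μ₀ : PMF (State N)} (g : State N → ℝ) {lam τ : ℝ}
    {P : Measure (Path N)} (hP : IsChainLaw μ₀ (baseRates N lam τ) P) :
    ∫ X, Real.exp (doobLogDensity (fun y => Real.exp (-g y / τ)) (desirability g lam τ 0) X) ∂P = 1
      ∧ HasLawAt μ₀ (optimalKernel g lam τ) univ (optimalLaw g lam τ P) := by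
  have := hP.1
  exact hP.hasLawAt_flipKernel.tilted (fun y => Real.exp_pos _)
    (fun _ ht x => desirability_pos g lam τ ht.2 x) (fun _ _ _ => rfl)

lemma IsChainLaw.isProbabilityMeasure_optimalLaw {μ₀ : PMF (State N)} (g : State N → ℝ)
    {lam τ : ℝ} {P : Measure (Path N)} (hP : IsChainLaw μ₀ (baseRates N lam τ) P) :
    IsProbabilityMeasure (optimalLaw g lam τ P) := by
  have := hP.1
  obtain ⟨C, hC⟩ := exists_abs_doobLogDensity_le (fun y => Real.exp (-g y / τ))
    (desirability g lam τ 0)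
  exact isProbabilityMeasure_tilted
    (integrable_exp_of_abs_le (measurable_doobLogDensity _ _) hC)

lemma IsChainLaw.isChainLaw_optimalLaw {μ₀ : PMF (State N)} (g : State N → ℝ) {lam τ : ℝ}
    {P : Measure (Path N)} (hP : IsChainLaw μ₀ (baseRates N lam τ) P) :
    IsChainLaw μ₀ (optimalRates g lam τ) (optimalLaw g lam τ P) :=
  isChainLaw_iff.2 ⟨hP.isProbabilityMeasure_optimalLaw g, _,
    isTransitionFunction_optimalKernel g lam τ, (hP.optimalLaw_spec g).2⟩

/-! ### The cost as a divergence; existence and uniqueness -/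

lemma cost_eq_top {g : State N → ℝ} {τ : ℝ} (hτ : 0 < τ) {P R : Measure (Path N)}
    (h : InformationTheory.klDiv R P = ⊤) : cost g τ P R = ⊤ := by
  rw [cost, h, EReal.coe_ennreal_top, EReal.coe_mul_top_of_pos hτ, EReal.coe_add_top]

lemma cost_eq_coe {g : State N → ℝ} {τ : ℝ} {P R : Measure (Path N)}
    (h : InformationTheory.klDiv R P ≠ ⊤) :
    cost g τ P R = ((∫ X, g (X 1) ∂ R + τ * (InformationTheory.klDiv R P).toReal : ℝ) : EReal) := by
  rw [cost, ← EReal.coe_ennreal_toReal h]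
  norm_cast

/-- The cost is, up to a constant, the divergence from the law of the optimal control. -/
lemma IsChainLaw.cost_eq {μ₀ : PMF (State N)} (g : State N → ℝ) {lam τ : ℝ} (hτ : 0 < τ)
    {P R : Measure (Path N)} {v : Rates N} (hP : IsChainLaw μ₀ (baseRates N lam τ) P)
    (hR : IsChainLaw μ₀ v R) (h : InformationTheory.klDiv R P ≠ ⊤) :
    InformationTheory.klDiv R (optimalLaw g lam τ P) ≠ ⊤ ∧ cost g τ P R =
      ((τ * (InformationTheory.klDiv R (optimalLaw g lam τ P)).toReal -
        τ * ∑ x, Real.log (desirability g lam τ 0 x) * (μ₀ x).toReal : ℝ) : EReal) := by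
  have := hP.1
  obtain ⟨hRp, q, -, hlaw⟩ := isChainLaw_iff.1 hR
  obtain ⟨C, hC⟩ := exists_abs_doobLogDensity_le (fun y => Real.exp (-g y / τ))
    (desirability g lam τ 0)
  obtain ⟨h1, h2⟩ := klDiv_tilted_right (measurable_doobLogDensity _ _) hC h
  refine ⟨h1, ?_⟩
  -- The X_0 term depends only on the prescribed initial distribution, so it is the same for all
  -- controls.
  have hint : ∫ X, doobLogDensity (fun y => Real.exp (-g y / τ)) (desirability g lam τ 0) X ∂ R =
      -(∫ X, g (X 1) ∂ R) / τ - ∑ x, Real.log (desirability g lam τ 0 x) * (μ₀ x).toReal := by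
    simp only [doobLogDensity, Real.log_exp]
    rw [integral_sub (integrable_comp_eval R 1 fun z => -g z / τ)
      (integrable_comp_eval R 0 fun z => Real.log (desirability g lam τ 0 z)),
      integral_div, integral_neg,
      integral_comp_eval R 0 fun z => Real.log (desirability g lam τ 0 z)]
    simp only [hlaw.initial]
  rw [(hP.optimalLaw_spec g).1, hint, Real.log_one] at h2
  rw [cost_eq_coe h, optimalLaw, h2]
  congr 1
  field_simp
  ring

lemma IsChainLaw.cost_optimalLaw {μ₀ : PMF (State N)} (g : State N → ℝ) {lam τ : ℝ} (hτ : 0 < τ)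
    {P : Measure (Path N)} (hP : IsChainLaw μ₀ (baseRates N lam τ) P) :
    cost g τ P (optimalLaw g lam τ P) =
      ((-(τ * ∑ x, Real.log (desirability g lam τ 0 x) * (μ₀ x).toReal) : ℝ) : EReal) := by
  have := hP.1
  have := hP.isProbabilityMeasure_optimalLaw g
  obtain ⟨C, hC⟩ := exists_abs_doobLogDensity_le (fun y => Real.exp (-g y / τ))
    (desirability g lam τ 0)
  rw [(hP.cost_eq g hτ (hP.isChainLaw_optimalLaw g)
    (klDiv_tilted_self_ne_top (measurable_doobLogDensity _ _) hC)).2,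
    InformationTheory.klDiv_self]
  simp

lemma IsChainLaw.cost_optimalLaw_le {μ₀ : PMF (State N)} (g : State N → ℝ) {lam τ : ℝ}
    (hτ : 0 < τ) {P R : Measure (Path N)} {v : Rates N}
    (hP : IsChainLaw μ₀ (baseRates N lam τ) P) (hR : IsChainLaw μ₀ v R) :
    cost g τ P (optimalLaw g lam τ P) ≤ cost g τ P R := by
  by_cases h : InformationTheory.klDiv R P = ⊤
  · rw [cost_eq_top hτ h]; exact le_top
  · rw [hP.cost_optimalLaw g hτ, (hP.cost_eq g hτ hR h).2, EReal.coe_le_coe_iff]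
    have := mul_nonneg hτ.le
      (ENNReal.toReal_nonneg (a := InformationTheory.klDiv R (optimalLaw g lam τ P)))
    linarith

/-- The law of an optimally controlled chain is unique. -/
lemma IsChainLaw.eq_optimalLaw {μ₀ : PMF (State N)} (g : State N → ℝ) {lam τ : ℝ}
    (hτ : 0 < τ) {P R : Measure (Path N)} {v : Rates N}
    (hP : IsChainLaw μ₀ (baseRates N lam τ) P) (hR : IsChainLaw μ₀ v R)
    (hle : cost g τ P R ≤ cost g τ P (optimalLaw g lam τ P)) : R = optimalLaw g lam τ P := by
  have := hR.1
  have := hP.isProbabilityMeasure_optimalLaw g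
  rw [hP.cost_optimalLaw g hτ] at hle
  have h : InformationTheory.klDiv R P ≠ ⊤ := by
    intro h
    rw [cost_eq_top hτ h, top_le_iff] at hle
    exact EReal.coe_ne_top _ hle
  obtain ⟨h1, h2⟩ := hP.cost_eq g hτ hR h
  rw [h2, EReal.coe_le_coe_iff] at hle
  have h0 : (InformationTheory.klDiv R (optimalLaw g lam τ P)).toReal = 0 := by
    refine le_antisymm ?_ ENNReal.toReal_nonneg
    by_contra! hpos
    have := mul_pos hτ hpos
    linarith
  exact InformationTheory.klDiv_eq_zero_iff.1 (((ENNReal.toReal_eq_zero_iff _).1 h0).resolve_right h1)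

/-- An optimal control exists. -/
theorem exists_isOptimalControl (g : State N → ℝ) (lam : ℝ) {τ : ℝ} (hτ : 0 < τ)
    (μ₀ : PMF (State N)) : ∃ u : Rates N, IsOptimalControl g lam τ μ₀ u := by
  obtain ⟨P, hP⟩ := exists_isChainLaw_baseRates μ₀ lam τ
  exact ⟨optimalRates g lam τ, isAdmissible_optimalRates g lam τ, P, optimalLaw g lam τ P, hP,
    hP.isChainLaw_optimalLaw g, fun v R _ hR => hP.cost_optimalLaw_le g hτ hR⟩

/-- The optimal control is unique at all times before the final time. -/
theorem IsOptimalControl.eq_optimalRates {g : State N → ℝ} {lam τ : ℝ} (hτ : 0 < τ)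
    {μ₀ : PMF (State N)} {u : Rates N} (hu : IsOptimalControl g lam τ μ₀ u) {t : ℝ}
    (ht : t ∈ Ico (0 : ℝ) 1) (x y : State N) : u t y x = optimalRates g lam τ t y x := by
  obtain ⟨hadm, P, Q, hP, hQ, hopt⟩ := hu
  have hQP : Q = optimalLaw g lam τ P := hP.eq_optimalLaw g hτ hQ
    (hopt _ _ (isAdmissible_optimalRates g lam τ) (hP.isChainLaw_optimalLaw g))
  obtain ⟨-, p, hp, hlaw⟩ := isChainLaw_iff.1 hQ
  have hlaw' := (hP.optimalLaw_spec g).2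
  rw [← hQP] at hlaw'
  obtain ⟨x₀, hx₀⟩ := μ₀.support_nonempty
  have hx₀' : (μ₀ x₀).toReal ≠ 0 :=
    ENNReal.toReal_ne_zero.2 ⟨(PMF.mem_support_iff _ _).1 hx₀, PMF.apply_ne_top _ _⟩
  -- For s > 0 every state `x` is reached from `x₀` with positive probability, so the weight of (x₀,
  -- x) cancels between the three-time and two-time distributions. At s = 0 this would fail outside
  -- the support of μ₀.
  have hker : ∀ s ∈ Ioo (0 : ℝ) 1, ∀ r ∈ Icc s 1, ∀ x y,
      p s r y x = optimalKernel g lam τ s r y x := by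
    intro s hs r hr x y
    let s' : unitInterval := ⟨s, hs.1.le, hs.2.le⟩
    let r' : unitInterval := ⟨r, hs.1.le.trans hr.1, hr.2⟩
    let T₁ : Fin 2 → unitInterval := Fin.snoc (fun _ : Fin 1 => 0) s'
    let Y₁ : Fin 2 → State N := Fin.snoc (fun _ : Fin 1 => x₀) x
    have hT₁ : Monotone T₁ := monotone_snoc (t := fun _ : Fin 1 => 0) monotone_const s'.2.1
    have hT₁0 : T₁ 0 = 0 := snoc_zero _ _
    have hlast : T₁ (Fin.last 1) = s' := Fin.snoc_last _ _
    have hlast' : Y₁ (Fin.last 1) = x := Fin.snoc_last _ _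
    have e1 := (hlaw 1 T₁ Y₁ hT₁ hT₁0 fun _ => mem_univ _).symm.trans
      (hlaw' 1 T₁ Y₁ hT₁ hT₁0 fun _ => mem_univ _)
    have hpos : pathWeight μ₀ (optimalKernel g lam τ) T₁ Y₁ ≠ 0 := by
      rw [pathWeight_snoc]
      refine mul_ne_zero ?_ (optimalKernel_pos g lam τ hs.1 hs.2.le _ _).ne'
      simpa [pathWeight] using hx₀'
    have hT₂ : Monotone (Fin.snoc T₁ r' : Fin 3 → unitInterval) :=
      monotone_snoc hT₁ (by rw [hlast]; exact hr.1)
    have hT₂0 : (Fin.snoc T₁ r' : Fin 3 → unitInterval) 0 = 0 := by rw [snoc_zero, hT₁0]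
    have e2 := (hlaw 2 _ (Fin.snoc Y₁ y : Fin 3 → State N) hT₂ hT₂0 fun _ => mem_univ _).symm.trans
      (hlaw' 2 _ _ hT₂ hT₂0 fun _ => mem_univ _)
    rw [pathWeight_snoc μ₀ p T₁ Y₁, pathWeight_snoc μ₀ _ T₁ Y₁, e1, hlast, hlast'] at e2
    exact mul_left_cancel₀ hpos e2
  have hderiv : ∀ (v : Rates N) (q : ℝ → ℝ → State N → State N → ℝ), IsTransitionFunction v q →
      ∀ s ∈ Ioo (0 : ℝ) 1, ∀ x y, HasDerivWithinAt (fun r => q s r y x) (v s y x) (Icc s 1) s := by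
    intro v q hq s hs x y
    have hs' : s ∈ Icc (0 : ℝ) 1 := Ioo_subset_Icc_self hs
    refine (hq.forward s hs' s ⟨le_rfl, hs.2.le⟩ x y).congr_deriv ?_
    simp [hq.initial s hs']
  have hin : EqOn (fun s => u s y x) (fun s => optimalRates g lam τ s y x) (Ioo 0 1) := by
    intro s hs
    have h1 := hderiv u p hp s hs x y
    have h2 := hderiv _ _ (isTransitionFunction_optimalKernel g lam τ) s hs x y
    have h3 : HasDerivWithinAt (fun r => p s r y x) (optimalRates g lam τ s y x) (Icc s 1) s :=
      h2.congr (fun r hr => hker s hs r hr x y) (hker s hs s ⟨le_rfl, hs.2.le⟩ x y)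
    exact (uniqueDiffOn_Icc hs.2 s ⟨le_rfl, hs.2.le⟩).eq_deriv _ h1 h3
  -- Continuity in time extends the equality to t = 0.
  refine hin.of_subset_closure (hadm.continuous x y)
    ((isAdmissible_optimalRates g lam τ).continuous x y) Ioo_subset_Icc_self ?_
    (Ico_subset_Icc_self ht)
  rw [closure_Ioo zero_ne_one]

/-! ### Asymptotics as τ → 0 -/

lemma optimalRates_flip (g : State N → ℝ) (lam τ t : ℝ) (x : State N) (i : Fin N) :
    optimalRates g lam τ t (flip x i) x =
      baseRate lam τ * desirability g lam τ t (flip x i) / desirability g lam τ t x := by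
  rw [optimalRates, doobRates_of_ne _ _ _ (flip_ne x i), baseRates_flip]

/-- The odds of a bit flip. -/
def flipOdds (ρ r : ℝ) : ℝ := bitProb ρ r false / bitProb ρ r true

lemma flipOdds_pos {ρ r : ℝ} (hρ : 0 < ρ) (hr : 0 < r) : 0 < flipOdds ρ r :=
  div_pos (bitProb_pos hρ hr _) (bitProb_true_pos _ _)

/-- The prefactor does not depend on `x`, so it cancels in the rates; `m` will be the minimum of
`g`. -/
lemma desirability_eq (g : State N → ℝ) (m lam τ t : ℝ) (x : State N) :
    desirability g lam τ t x =
      bitProb (baseRate lam τ) (1 - t) true ^ N * Real.exp (-m / τ) *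
        ∑ y, flipOdds (baseRate lam τ) (1 - t) ^ hammingDist x y * Real.exp (-(g y - m) / τ) := by
  rw [desirability, Finset.mul_sum]
  refine Finset.sum_congr rfl fun y _ => ?_
  have : Real.exp (-g y / τ) = Real.exp (-m / τ) * Real.exp (-(g y - m) / τ) := by
    rw [← Real.exp_add]; congr 1; ring
  rw [flipKernel_eq_pow, this, flipOdds]
  ring

lemma tendsto_inv_nhdsGT_zero_mul {c : ℝ} (hc : 0 < c) :
    Tendsto (fun τ : ℝ => c / τ) (𝓝[>] 0) atTop :=
  (tendsto_inv_nhdsGT_zero.const_mul_atTop hc).congr fun τ => by rw [div_eq_mul_inv]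

lemma tendsto_baseRate {lam : ℝ} (hlam : 0 < lam) :
    Tendsto (fun τ => baseRate lam τ) (𝓝[>] 0) (𝓝[>] 0) := by
  refine tendsto_nhdsWithin_iff.2 ⟨?_, Eventually.of_forall fun τ => baseRate_pos lam τ⟩
  have h := tendsto_neg_atTop_atBot.comp (tendsto_inv_nhdsGT_zero_mul hlam)
  refine (Real.tendsto_sigmoid_atBot.comp h).congr fun τ => ?_
  simp [baseRate, neg_div]

/-- The flip probability vanishes at ρ = 0 with derivative `s`, while the probability of no net flip
tends to one. -/
lemma tendsto_flipOdds_div {s : ℝ} :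
    Tendsto (fun ρ => flipOdds ρ s / ρ) (𝓝[>] 0) (𝓝 s) := by
  have hd : HasDerivAt (fun ρ => bitProb ρ s false) s 0 := by
    have h : HasDerivAt (fun ρ : ℝ => Real.exp (-(2 * ρ * s)))
        (Real.exp (-(2 * 0 * s)) * (-(2 * 1 * s))) 0 :=
      ((((hasDerivAt_id (0 : ℝ)).const_mul 2).mul_const s).neg).exp
    simp only [bitProb, Bool.false_eq_true, if_false]
    exact ((h.const_sub 1).div_const 2).congr_deriv (by simp)
  have h1 : Tendsto (fun ρ => bitProb ρ s false / ρ) (𝓝[>] 0) (𝓝 s) := by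
    have := (hasDerivAt_iff_tendsto_slope.1 hd).mono_left
      (nhdsWithin_mono 0 (fun ρ (hρ : 0 < ρ) => hρ.ne' : Ioi (0 : ℝ) ⊆ {0}ᶜ))
    refine this.congr fun ρ => ?_
    simp [slope_def_field, bitProb]
  have h2 : Tendsto (fun ρ => bitProb ρ s true) (𝓝[>] 0) (𝓝 1) := by
    have : Continuous (fun ρ => bitProb ρ s true) := by
      simp only [bitProb, if_true]; fun_prop
    have h := this.tendsto 0
    simp only [bitProb, if_true] at h
    norm_num at h
    simpa [bitProb] using h.mono_left nhdsWithin_le_nhds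
  have := h1.div h2 one_ne_zero
  rw [div_one] at this
  refine this.congr fun ρ => ?_
  simp only [Pi.div_apply, flipOdds]
  rw [div_right_comm]

lemma tendsto_flipOdds {s : ℝ} : Tendsto (fun ρ => flipOdds ρ s) (𝓝[>] 0) (𝓝 0) := by
  have := (tendsto_flipOdds_div (s := s)).mul
    (tendsto_id.mono_left nhdsWithin_le_nhds : Tendsto (fun ρ : ℝ => ρ) (𝓝[>] 0) (𝓝 0))
  rw [mul_zero] at this
  refine this.congr' ?_
  filter_upwards [self_mem_nhdsWithin] with ρ hρ
  exact div_mul_cancel₀ _ (ne_of_gt hρ)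

/-- Excess costs larger than `N λ` dominate the odds of flipping all the bits. -/
lemma tendsto_exp_div_flipOdds_pow {lam s c : ℝ} (hlam : 0 < lam) (hs : 0 < s) (hc : N * lam < c) :
    Tendsto (fun τ => Real.exp (-c / τ) / flipOdds (baseRate lam τ) s ^ N) (𝓝[>] 0) (𝓝 0) := by
  have h1 : Tendsto (fun τ => (flipOdds (baseRate lam τ) s / baseRate lam τ)⁻¹ ^ N)
      (𝓝[>] 0) (𝓝 (s⁻¹ ^ N)) :=
    (((tendsto_flipOdds_div.comp (tendsto_baseRate hlam))).inv₀ hs.ne').pow N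
  have h2 : Tendsto (fun τ => Real.exp (-c / τ) / baseRate lam τ ^ N) (𝓝[>] 0) (𝓝 0) := by
    have hlim : Tendsto (fun τ => 2 ^ N * Real.exp (-((c - N * lam) / τ))) (𝓝[>] 0) (𝓝 0) := by
      have := (Real.tendsto_exp_neg_atTop_nhds_zero.comp
        (tendsto_inv_nhdsGT_zero_mul (sub_pos.2 hc))).const_mul (2 ^ N)
      simpa [Function.comp_def] using this
    refine squeeze_zero' (Eventually.of_forall fun τ => ?_) ?_ hlim
    · have := baseRate_pos lam τ
      positivity
    · filter_upwards [self_mem_nhdsWithin] with τ hτ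
      have hτ : 0 < τ := hτ
      -- The inverse sigmoid is 1 + exp(λ/τ), and 1 ≤ exp(λ/τ).
      have hle : (baseRate lam τ)⁻¹ ≤ 2 * Real.exp (lam / τ) := by
        rw [baseRate, Real.sigmoid_def, inv_inv, neg_div, neg_neg]
        have : 1 ≤ Real.exp (lam / τ) := Real.one_le_exp (div_pos hlam hτ).le
        linarith
      have hb := baseRate_pos lam τ
      calc Real.exp (-c / τ) / baseRate lam τ ^ N
          = Real.exp (-c / τ) * (baseRate lam τ)⁻¹ ^ N := by rw [inv_pow, div_eq_mul_inv]
        _ ≤ Real.exp (-c / τ) * (2 * Real.exp (lam / τ)) ^ N := by gcongr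
        _ = 2 ^ N * Real.exp (-((c - N * lam) / τ)) := by
          rw [mul_pow, ← Real.exp_nat_mul, mul_left_comm, ← Real.exp_add]
          congr 2
          ring
  have := h1.mul h2
  rw [mul_zero] at this
  refine this.congr fun τ => ?_
  have := (baseRate_pos lam τ).ne'
  have := (flipOdds_pos (baseRate_pos lam τ) hs).ne'
  rw [inv_div, div_pow]
  field_simp

/-- The rescaled sums over the terminal states concentrate on the closest minimizers. -/
lemma tendsto_sum_flipOdds {g : State N → ℝ} {m lam s : ℝ} (hlam : 0 < lam) (hs : 0 < s)
    (hgap : ∀ y, g y ≠ m → N * lam < g y - m) (x : State N) {d : ℕ} (hdN : d ≤ N)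
    (hd : ∀ y, g y = m → d ≤ hammingDist x y) :
    Tendsto (fun τ => (∑ y, flipOdds (baseRate lam τ) s ^ hammingDist x y *
        Real.exp (-(g y - m) / τ)) / flipOdds (baseRate lam τ) s ^ d) (𝓝[>] 0)
      (𝓝 (∑ y, if g y = m ∧ hammingDist x y = d then 1 else 0)) := by
  have hr := tendsto_flipOdds (s := s).comp (tendsto_baseRate hlam)
  have hr0 : ∀ τ, flipOdds (baseRate lam τ) s ≠ 0 := fun τ =>
    (flipOdds_pos (baseRate_pos lam τ) hs).ne'
  simp only [Finset.sum_div]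
  refine tendsto_finsetSum _ fun y _ => ?_
  by_cases hy : g y = m
  · simp only [hy, sub_self, neg_zero, zero_div, Real.exp_zero, mul_one, true_and]
    obtain ⟨k, hk⟩ := Nat.exists_eq_add_of_le (hd y hy)
    have hpow : ∀ τ, flipOdds (baseRate lam τ) s ^ (d + k) / flipOdds (baseRate lam τ) s ^ d =
        flipOdds (baseRate lam τ) s ^ k := fun τ => by
      rw [pow_add, mul_div_cancel_left₀ _ (pow_ne_zero _ (hr0 τ))]
    simp only [hk, hpow]
    have h := hr.pow k
    simpa [zero_pow_eq, Function.comp_def] using h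
  · simp only [hy, false_and, if_false]
    -- Dividing by the d-th power of the odds is multiplying by the (N - d)-th power and dividing by
    -- the N-th, which the excess cost of `y` dominates.
    have h := (hr.pow (hammingDist x y + (N - d))).mul
      (tendsto_exp_div_flipOdds_pow (N := N) hlam hs (hgap y hy))
    rw [mul_zero] at h
    refine h.congr fun τ => ?_
    have hN : flipOdds (baseRate lam τ) s ^ N =
        flipOdds (baseRate lam τ) s ^ (N - d) * flipOdds (baseRate lam τ) s ^ d := by
      rw [← pow_add, Nat.sub_add_cancel hdN]
    have := hr0 τ
    simp only [Function.comp_apply]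
    rw [hN, pow_add]
    field_simp

/-- Numerator and denominator are scaled by the same power `d`, left free so that it can be matched
to the distance to the closest minimizer. -/
lemma optimalRates_flip_eq_div (g : State N → ℝ) (m lam τ : ℝ) {t : ℝ} (ht : t < 1) (x : State N)
    (i : Fin N) (d : ℕ) :
    optimalRates g lam τ t (flip x i) x = baseRate lam τ *
      ((∑ y, flipOdds (baseRate lam τ) (1 - t) ^ hammingDist (flip x i) y *
          Real.exp (-(g y - m) / τ)) / flipOdds (baseRate lam τ) (1 - t) ^ d) /
      ((∑ y, flipOdds (baseRate lam τ) (1 - t) ^ hammingDist x y *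
          Real.exp (-(g y - m) / τ)) / flipOdds (baseRate lam τ) (1 - t) ^ d) := by
  have h0 := (flipOdds_pos (baseRate_pos lam τ) (sub_pos.2 ht)).ne'
  have h1 := (bitProb_true_pos (baseRate lam τ) (1 - t)).ne'
  have h2 := (Real.exp_pos (-m / τ)).ne'
  have h3 := (desirability_pos g lam τ ht.le x).ne'
  rw [desirability_eq g m] at h3
  have h4 := right_ne_zero_of_mul h3
  rw [optimalRates_flip, desirability_eq g m, desirability_eq g m]
  field_simp

lemma IsMinimizer.eq {g : State N → ℝ} {y z : State N} (hy : IsMinimizer g y)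
    (hz : IsMinimizer g z) : g y = g z := le_antisymm (hy z) (hz y)

/-- The optimal rates converge to the rates of the shortest bridge to the closest minimizer. -/
theorem tendsto_optimalRates {g : State N → ℝ} {lam : ℝ} (hlam : 0 < lam) {x xs : State N}
    (hgap : ∀ y, g y ≠ g xs → N * lam < g y - g xs) (hxs : IsUniqueClosestMinimizer g x xs)
    {t : ℝ} (ht : t < 1) (i : Fin N) :
    Tendsto (fun τ => optimalRates g lam τ t (flip x i) x) (𝓝[>] 0)
      (𝓝 (if x i ≠ xs i then 1 / (1 - t) else 0)) := by
  have hs : 0 < 1 - t := sub_pos.2 ht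
  have hmin : ∀ y, g y = g xs → y ≠ xs → hammingDist x xs < hammingDist x y := fun y hy hne =>
    hxs.2 y (fun z => hy ▸ hxs.1 z) hne
  have hN : hammingDist x xs ≤ N := by simpa using hammingDist_le_card_fintype (x := x) (y := xs)
  have hcount : ∀ (z : State N) (d : ℕ), hammingDist z xs = d →
      (∀ y, g y = g xs → y ≠ xs → d < hammingDist z y) →
      (∑ y, if g y = g xs ∧ hammingDist z y = d then (1 : ℝ) else 0) = 1 := by
    intro z d hd h
    rw [Finset.sum_eq_single xs]
    · simp [hd]
    · intro y _ hne
      refine if_neg fun hy => ?_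
      exact (h y hy.1 hne).ne' hy.2
    · simp
  have hle : ∀ (z : State N) (d : ℕ), hammingDist z xs = d →
      (∀ y, g y = g xs → y ≠ xs → d < hammingDist z y) →
      ∀ y, g y = g xs → d ≤ hammingDist z y := by
    intro z d hd h y hy
    by_cases hne : y = xs
    · rw [hne, hd]
    · exact (h y hy hne).le
  have hden := tendsto_sum_flipOdds hlam hs hgap x hN (hle x _ rfl hmin)
  rw [hcount x _ rfl hmin] at hden
  split_ifs with hi
  · have hd := hammingDist_flip_of_ne hi
    -- One flip brings any other minimizer closer by at most one, and `xs` closer by exactly one, so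
    -- `xs` remains the unique closest.
    have hmin' : ∀ y, g y = g xs → y ≠ xs →
        hammingDist (flip x i) xs < hammingDist (flip x i) y := by
      intro y hy hne
      have h1 := hmin y hy hne
      by_cases hxy : x i = y i
      · have := hammingDist_flip_of_eq hxy; omega
      · have := hammingDist_flip_of_ne hxy; omega
    have hnum := tendsto_sum_flipOdds hlam hs hgap (flip x i) (by omega) (hle _ _ rfl hmin')
    rw [hcount _ _ rfl hmin'] at hnum
    -- The numerator has leading power one lower than the denominator; the base rate divided by this
    -- spare factor of the odds tends to 1/(1 - t).
    have hrate := ((tendsto_flipOdds_div (s := 1 - t)).comp (tendsto_baseRate hlam)).inv₀ hs.ne'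
    have h := (hrate.mul hnum).div hden one_ne_zero
    simp only [mul_one, div_one] at h
    rw [one_div]
    refine h.congr fun τ => ?_
    rw [optimalRates_flip_eq_div g (g xs) lam τ ht x i (hammingDist x xs)]
    have h0 := (flipOdds_pos (baseRate_pos lam τ) hs).ne'
    simp only [Pi.div_apply, Function.comp_apply, inv_div]
    congr 1
    rw [hd, pow_succ]
    field_simp
  · have hi : x i = xs i := not_not.1 hi
    have hd := hammingDist_flip_of_eq hi
    -- After this flip other minimizers may tie at the old distance but cannot be closer. The scaled
    -- numerator thus has a finite limit, and the vanishing base rate decides.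
    have hmin' : ∀ y, g y = g xs → hammingDist x xs ≤ hammingDist (flip x i) y := by
      intro y hy
      by_cases hne : y = xs
      · rw [hne, hd]; omega
      have h1 := hmin y hy hne
      by_cases hxy : x i = y i
      · have := hammingDist_flip_of_eq hxy; omega
      · have := hammingDist_flip_of_ne hxy; omega
    have hnum := tendsto_sum_flipOdds hlam hs hgap (flip x i) hN hmin'
    have hrate := (tendsto_baseRate hlam).mono_right nhdsWithin_le_nhds
    have h := (hrate.mul hnum).div hden one_ne_zero
    simp only [zero_mul, div_one] at h
    refine h.congr fun τ => ?_
    rw [optimalRates_flip_eq_div g (g xs) lam τ ht x i (hammingDist x xs)]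
    rfl

/-- Finiteness of the state space gives the gap between the two lowest values; for constant `g` any
positive number, here 1, serves. -/
lemma exists_gap (g : State N → ℝ) :
    ∃ δ : ℝ, 0 < δ ∧ ∀ xs y, IsMinimizer g xs → g y ≠ g xs → δ ≤ g y - g xs := by
  obtain ⟨xm, -, hxm⟩ := Finset.univ.exists_min_image g Finset.univ_nonempty
  have hm : IsMinimizer g xm := fun z => hxm z (Finset.mem_univ z)
  by_cases hne : (Finset.univ.filter fun y => g y ≠ g xm).Nonempty
  · obtain ⟨y₀, hy₀, hmin⟩ := Finset.exists_min_image _ g hne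
    refine ⟨g y₀ - g xm, ?_, fun xs y hxs hy => ?_⟩
    · exact sub_pos.2 (lt_of_le_of_ne (hm y₀) (Finset.mem_filter.1 hy₀).2.symm)
    · rw [hxs.eq hm] at hy ⊢
      exact sub_le_sub_right (hmin y (by simpa using hy)) _
  · refine ⟨1, one_pos, fun xs y hxs hy => absurd ⟨y, ?_⟩ hne⟩
    rw [hxs.eq hm] at hy
    simpa using hy

end BitFlipControl

end

theorem proposition1 (N : ℕ) (g : BitFlipControl.State N → ℝ) :
    (∀ lam : ℝ, 0 < lam → ∀ τ : ℝ, 0 < τ → ∀ μ₀ : PMF (BitFlipControl.State N),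
      ∃ u : BitFlipControl.Rates N, BitFlipControl.IsOptimalControl g lam τ μ₀ u) ∧
    ∃ lam₀ : ℝ, 0 < lam₀ ∧ ∀ lam : ℝ, 0 < lam → lam < lam₀ →
      ∀ (μ₀ : PMF (BitFlipControl.State N)) (u : ℝ → BitFlipControl.Rates N),
        (∀ τ : ℝ, 0 < τ → BitFlipControl.IsOptimalControl g lam τ μ₀ (u τ)) →
        ∀ x xs : BitFlipControl.State N, BitFlipControl.IsUniqueClosestMinimizer g x xs →
          ∀ t ∈ Set.Ico (0 : ℝ) 1, ∀ i : Fin N,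
            Filter.Tendsto (fun τ : ℝ => u τ t (BitFlipControl.flip x i) x)
              (nhdsWithin 0 (Set.Ioi 0))
              (nhds (if x i ≠ xs i then 1 / (1 - t) else 0)) := by
  refine ⟨fun lam _ τ hτ μ₀ => BitFlipControl.exists_isOptimalControl g lam hτ μ₀, ?_⟩
  obtain ⟨δ, hδ, hgap⟩ := BitFlipControl.exists_gap g
  -- Only Nλ < δ is needed; N + 1 avoids division by zero when N = 0.
  refine ⟨δ / (N + 1), by positivity, ?_⟩
  intro lam hlam hlt μ₀ u hu x xs hxs t ht i
  have hNlam : N * lam < δ := by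
    rw [lt_div_iff₀ (by positivity)] at hlt
    linarith
  refine (BitFlipControl.tendsto_optimalRates hlam
    (fun y hy => hNlam.trans_le (hgap xs y hxs.1 hy)) hxs ht.2 i).congr' ?_
  filter_upwards [self_mem_nhdsWithin] with τ hτ
  exact ((hu τ hτ).eq_optimalRates hτ ht x _).symm
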